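/- Let $N\ge 1$ be an integer, $0<s\le 1$ and $1<p<\infty$ with $s\,p>N$, and put $\alpha_{s,p}=s-\frac{N}{p}$. For $\varphi:\mathbb{R}^N\to\mathbb{R}$ set \[ [\varphi]_{W^{s,p}(\mathbb{R}^N)}=\begin{cases}\displaystyle\left(\iint_{\mathbb{R}^N\times\mathbb{R}^N}\frac{|\varphi(x)-\varphi(y)|^p}{|x-y|^{N+s\,p}}\,dx\,dy\right)^{1/p}, & 0<s<1,\\[3mm] \displaystyle\left(\int_{\mathbb{R}^N}|\nabla\varphi|^p\,dx\right)^{1/p}, & s=1,\end{cases} \qquad [\varphi]_{C^{0,\alpha}(\mathbb{R}^N)}=\sup_{x\neq y}\frac{|\varphi(x)-\varphi(y)|}{|x-y|^{\alpha}}, \] where $\nabla\varphi$ is the weak gradient (the seminorm for $s=1$ being $+\infty$ if $\varphi$ has no locally integrable weak gradient). Let \[ \mathcal{W}^{s,p}(\mathbb{R}^N)=\Big\{\varphi:\mathbb{R}^N\to\mathbb{R}\ \text{continuous}\,:\,[\varphi]_{C^{0,\alpha_{s,p}}(\mathbb{R}^N)}<+\infty,\ [\varphi]_{W^{s,p}(\mathbb{R}^N)}<+\infty\Big\}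 \] and \[ \mathfrak{m}_{s,p}(\mathbb{R}^N)=\inf_{\varphi\in C^\infty_0(\mathbb{R}^N)}\Big\{[\varphi]^p_{W^{s,p}(\mathbb{R}^N)}\,:\,[\varphi]_{C^{0,\alpha_{s,p}}(\mathbb{R}^N)}=1\Big\}, \] where $C^\infty_0(\mathbb{R}^N)$ is the space of smooth real functions with compact support. Then \[ \mathfrak{m}_{s,p}(\mathbb{R}^N)=\inf_{\varphi\in\mathcal{W}^{s,p}(\mathbb{R}^N)}\Big\{[\varphi]^p_{W^{s,p}(\mathbb{R}^N)}\,:\,[\varphi]_{C^{0,\alpha_{s,p}}(\mathbb{R}^N)}=1\Big\}. \] Moreover, the infimum on the right-hand side is attained. In particular there is an extremal for $\mathfrak{m}_{s,p}(\mathbb{R}^N)$, that is, a non-constant $u\in\mathcal{W}^{s,p}(\mathbb{R}^N)$ with $[u]^p_{W^{s,p}(\mathbb{R}^N)}=\mathfrak{m}_{s,p}(\mathbb{R}^N)\,[u]^p_{C^{0,\alpha_{s,p}}(\mathbb{R}^N)}$. -/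

import Mathlib

open MeasureTheory
open scoped ENNReal ContDiff

namespace Morrey

/-- The Euclidean space `ℝ^N`. -/
abbrev Space (N : ℕ) : Type := EuclideanSpace ℝ (Fin N)

/-- The class `C^∞_0(ℝ^N)` of smooth real functions with compact support. -/
def TestFun (N : ℕ) : Set (Space N → ℝ) :=
  {ψ | ContDiff ℝ ∞ ψ ∧ HasCompactSupport ψ}

/-- `G` is a weak (distributional) gradient of `φ` on `ℝ^N`. It is unique up to null sets. -/
structure IsWeakGradient {N : ℕ} (φ : Space N → ℝ) (G : Space N → Space N) : Prop where
  locallyIntegrable : LocallyIntegrable φ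
  locallyIntegrable_grad : LocallyIntegrable G
  integral_eq : ∀ ψ ∈ TestFun N, ∀ v : Space N,
    ∫ x, φ x * fderiv ℝ ψ x v = -∫ x, ψ x * inner ℝ (G x) v

/-- The Gagliardo-Slobodeckij seminorm
`(∬ |φ(x) - φ(y)|^p / |x - y|^(N + s p) dx dy)^(1/p)`, with values in `[0, ∞]`. -/
noncomputable def gagliardoSeminorm {N : ℕ} (s p : ℝ) (φ : Space N → ℝ) : ℝ≥0∞ :=
  (∫⁻ z : Space N × Space N,
    ‖φ z.1 - φ z.2‖ₑ ^ p / ‖z.1 - z.2‖ₑ ^ ((N : ℝ) + s * p)) ^ (1 / p)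

/-- The first order seminorm `(∫ |∇φ|^p dx)^(1/p)`, where `∇φ` is the weak gradient of `φ`,
with value `∞` if there is no locally integrable weak gradient. As weak gradients of `φ` agree
almost everywhere, the infimum runs over a set with at most one element. -/
noncomputable def gradientSeminorm {N : ℕ} (p : ℝ) (φ : Space N → ℝ) : ℝ≥0∞ :=
  ⨅ (G : Space N → Space N) (_ : IsWeakGradient φ G), (∫⁻ x, ‖G x‖ₑ ^ p) ^ (1 / p)

open Classical in
/-- The seminorm `[φ]_{W^{s,p}(ℝ^N)}` for `0 < s ≤ 1`, with values in `[0, ∞]`. -/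
noncomputable def sobolevSeminorm {N : ℕ} (s p : ℝ) (φ : Space N → ℝ) : ℝ≥0∞ :=
  if s = 1 then gradientSeminorm p φ else gagliardoSeminorm s p φ

/-- The Hölder seminorm `[φ]_{C^{0,α}(ℝ^N)}`, with values in `[0, ∞]`. -/
noncomputable def holderSeminorm {N : ℕ} (α : ℝ) (φ : Space N → ℝ) : ℝ≥0∞ :=
  ⨆ (x : Space N) (y : Space N) (_ : x ≠ y), ‖φ x - φ y‖ₑ / ‖x - y‖ₑ ^ α

/-- The exponent `α_{s,p} = s - N / p`. -/
noncomputable def holderExponent (N : ℕ) (s p : ℝ) : ℝ := s - N / p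

/-- The homogeneous Hölder space: continuous functions with finite Hölder seminorm. -/
def HomogeneousHolder (N : ℕ) (α : ℝ) : Set (Space N → ℝ) :=
  {φ | Continuous φ ∧ holderSeminorm α φ < ⊤}

/-- The space `𝒲^{s,p}(ℝ^N)` of the functions in the homogeneous Hölder space of exponent
`α_{s,p}` whose `W^{s,p}` seminorm is finite. -/
def HomogeneousSobolev (N : ℕ) (s p : ℝ) : Set (Space N → ℝ) :=
  {φ | φ ∈ HomogeneousHolder N (holderExponent N s p) ∧ sobolevSeminorm s p φ < ⊤}

/-- The sharp Morrey constant `𝔪_{s,p}(ℝ^N)`: the infimum of `[φ]_{W^{s,p}}^p` over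
`φ ∈ C^∞_0(ℝ^N)` with `[φ]_{C^{0,α_{s,p}}} = 1`. -/
noncomputable def morreyConstant (N : ℕ) (s p : ℝ) : ℝ≥0∞ :=
  ⨅ (φ ∈ TestFun N) (_ : holderSeminorm (holderExponent N s p) φ = 1),
    sobolevSeminorm s p φ ^ p

/-- The infimum of `[φ]_{W^{s,p}}^p` over `φ ∈ 𝒲^{s,p}(ℝ^N)` with
`[φ]_{C^{0,α_{s,p}}} = 1`. -/
noncomputable def relaxedMorreyConstant (N : ℕ) (s p : ℝ) : ℝ≥0∞ :=
  ⨅ (φ ∈ HomogeneousSobolev N s p) (_ : holderSeminorm (holderExponent N s p) φ = 1),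
    sobolevSeminorm s p φ ^ p

/-- Extremals for `𝔪_{s,p}(ℝ^N)`: non-constant functions `u ∈ 𝒲^{s,p}(ℝ^N)` with equality in
the sharp Morrey inequality. -/
structure IsExtremal {N : ℕ} (s p : ℝ) (u : Space N → ℝ) : Prop where
  mem : u ∈ HomogeneousSobolev N s p
  nonconstant : ¬ ∃ c : ℝ, ∀ x, u x = c
  eq : sobolevSeminorm s p u ^ p =
    morreyConstant N s p * holderSeminorm (holderExponent N s p) u ^ p

end Morrey

/-!
The proof has two halves: the two infima agree, and the infimum is attained.

**Equality of the infima.** Let `c = 𝔪_{s,p} ^ (1 / p)`. By homogeneity every test function `f`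
satisfies `c |f x - f y| ≤ [f]_W |x - y| ^ α` (`MorreyBound`), and this has to be extended to all
continuous functions. The inequality passes to pointwise limits along which `[·]_W` does not
increase (`MorreyBound.of_tendsto`), so three approximations suffice. A continuous `u` is the
limit of its mollifications, whose seminorms are at most that of `u` by Jensen's inequality
(`sobolevSeminorm_mollify_le`). A smooth `f` is the limit of the bounded functions
`M sin (f / M)`; as `M sin (· / M)` is a contraction, it lowers the seminorm
(`sobolevSeminorm_mul_sin_le`). A bounded smooth `f` is the limit of `f η(· / R)` with a fixed
cut-off function `η`, and `[f η(· / R)]_W ≤ [f]_W + sup |f| [η(· / R)]_W`, where the last term is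
of order `R ^ (-α)` by scaling. This is where boundedness is needed, and where `α > 0`, that is
`s p > N`, is used.

**Existence.** Both seminorms are invariant under translations, additive constants and suitably
normalised dilations. Hence there are almost minimisers `g n` with `g n 0 = 0`, Hölder seminorm at
most one, and `g n (e n) → 1` for unit vectors `e n` (`exists_almost_extremal`). By the theorem of
Arzelà and Ascoli a subsequence converges locally uniformly to some `u`, and `e n → w`; then
`u w - u 0 = 1`, so `u` has Hölder seminorm one. It remains to see that `[u]_W ^ p ≤ 𝔪_{s,p}`. For
`s < 1` this is Fatou's lemma. For `s = 1` the midpoint of `g n` and `g k` still has Hölder seminorm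
close to one, so the `L ^ p` norm of its gradient is almost at least the infimum; uniform convexity
makes the gradients a Cauchy sequence in `L ^ p` (`exists_tendsto_eLpNorm_sub_of_midpoint`), and
their limit is the weak gradient of `u` (`IsWeakGradient.of_tendsto`).
-/

namespace Morrey

open Filter Topology

variable {N : ℕ}

/-! ### The first order seminorm of functions of class `C¹` -/

theorem isWeakGradient_gradient {f : Space N → ℝ} (hf : ContDiff ℝ 1 f) :
    IsWeakGradient f (gradient f) where
  locallyIntegrable := hf.continuous.locallyIntegrable
  locallyIntegrable_grad :=
    ((InnerProductSpace.toDual ℝ (Space N)).symm.continuous.comp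
      (hf.continuous_fderiv one_ne_zero)).locallyIntegrable
  integral_eq := by
    rintro ψ ⟨hψ, hψc⟩ v
    have hf' : Continuous fun x => fderiv ℝ f x v :=
      (hf.continuous_fderiv one_ne_zero).clm_apply continuous_const
    have hψ' : Continuous fun x => fderiv ℝ ψ x v :=
      (hψ.continuous_fderiv (by simp)).clm_apply continuous_const
    have hψc' : HasCompactSupport fun x => fderiv ℝ ψ x v :=
      (hψc.fderiv ℝ).comp_left (g := fun L : Space N →L[ℝ] ℝ => L v) rfl
    rw [integral_mul_fderiv_eq_neg_fderiv_mul_of_integrable]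
    · congr 1
      refine integral_congr_ae (.of_forall fun x => ?_)
      simp only [gradient, InnerProductSpace.toDual_symm_apply]
      ring
    · exact (hf'.mul hψ.continuous).integrable_of_hasCompactSupport hψc.mul_left
    · exact (hf.continuous.mul hψ').integrable_of_hasCompactSupport hψc'.mul_left
    · exact (hf.continuous.mul hψ.continuous).integrable_of_hasCompactSupport hψc.mul_left
    · exact fun x _ => (hf.differentiable one_ne_zero) x
    · exact fun x _ => (hψ.differentiable (by simp)) x

theorem IsWeakGradient.ae_eq {φ : Space N → ℝ} {G H : Space N → Space N}
    (hG : IsWeakGradient φ G) (hH : IsWeakGradient φ H) : G =ᵐ[volume] H := by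
  have key : ∀ᵐ x, (G - H) x = 0 := by
    refine ae_eq_zero_of_integral_contDiff_smul_eq_zero
      (hG.locallyIntegrable_grad.sub hH.locallyIntegrable_grad) fun ψ hψ hψc => ?_
    have hi : ∀ {K : Space N → Space N}, LocallyIntegrable K →
        Integrable fun x => ψ x • K x := fun hK =>
      hK.integrable_smul_left_of_hasCompactSupport hψ.continuous hψc
    refine ext_inner_right ℝ fun v => ?_
    rw [inner_zero_left]
    simp only [Pi.sub_apply, smul_sub]
    rw [integral_sub (hi hG.locallyIntegrable_grad) (hi hH.locallyIntegrable_grad),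
      inner_sub_left]
    have hv : ∀ {K : Space N → Space N}, LocallyIntegrable K →
        inner ℝ (∫ x, ψ x • K x) v = ∫ x, ψ x * inner ℝ (K x) v := fun hK => by
      rw [real_inner_comm, ← integral_inner (hi hK)]
      refine integral_congr_ae (.of_forall fun x => ?_)
      simp only [inner_smul_right, real_inner_comm]
    rw [hv hG.locallyIntegrable_grad, hv hH.locallyIntegrable_grad, sub_eq_zero]
    have h1 := hG.integral_eq ψ ⟨hψ, hψc⟩ v
    have h2 := hH.integral_eq ψ ⟨hψ, hψc⟩ v
    linarith
  filter_upwards [key] with x hx using sub_eq_zero.1 hx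

theorem IsWeakGradient.gradientSeminorm_eq {p : ℝ} {φ : Space N → ℝ} {G : Space N → Space N}
    (hG : IsWeakGradient φ G) : gradientSeminorm p φ = (∫⁻ x, ‖G x‖ₑ ^ p) ^ (1 / p) := by
  refine le_antisymm (iInf₂_le G hG) (le_iInf₂ fun H hH => le_of_eq ?_)
  congr 1
  refine lintegral_congr_ae ?_
  filter_upwards [hG.ae_eq hH] with x hx
  rw [hx]

theorem enorm_gradient (f : Space N → ℝ) (x : Space N) : ‖gradient f x‖ₑ = ‖fderiv ℝ f x‖ₑ := by
  simp only [enorm_eq_iff_norm_eq, gradient, LinearIsometryEquiv.norm_map]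

theorem gradientSeminorm_of_contDiff {p : ℝ} {f : Space N → ℝ} (hf : ContDiff ℝ 1 f) :
    gradientSeminorm p f = (∫⁻ x, ‖fderiv ℝ f x‖ₑ ^ p) ^ (1 / p) := by
  simp_rw [(isWeakGradient_gradient hf).gradientSeminorm_eq, enorm_gradient]

/-! ### Behaviour of the seminorms under affine changes -/

theorem lintegral_comp_affine {E : Type*} [NormedAddCommGroup E] [NormedSpace ℝ E]
    [MeasurableSpace E] [BorelSpace E] [FiniteDimensional ℝ E] (μ : Measure E)
    [μ.IsAddHaarMeasure] (f : E → ℝ≥0∞) (a : E) {r : ℝ} (hr : 0 < r) :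
    ∫⁻ x, f (a + r • x) ∂μ = ENNReal.ofReal (r ^ Module.finrank ℝ E)⁻¹ * ∫⁻ x, f x ∂μ := by
  have h := lintegral_map_equiv (μ := μ) (fun x => f (a + x))
    (Homeomorph.smulOfNeZero r hr.ne').toMeasurableEquiv
  have h2 : Measure.map (Homeomorph.smulOfNeZero r hr.ne').toMeasurableEquiv μ =
      ENNReal.ofReal |(r ^ Module.finrank ℝ E)⁻¹| • μ := Measure.map_addHaar_smul μ hr.ne'
  rw [h2, lintegral_smul_measure, lintegral_add_left_eq_self f a, abs_of_pos (by positivity)] at h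
  exact h.symm

theorem gagliardoSeminorm_comp_affine {s p : ℝ} (hp : 1 < p) (φ : Space N → ℝ) (a : Space N)
    {r : ℝ} (hr : 0 < r) : gagliardoSeminorm s p (fun z => φ (a + r • z)) =
      ENNReal.ofReal (r ^ holderExponent N s p) * gagliardoSeminorm s p φ := by
  have hp0 : 0 < p := by linarith
  have hR : 0 < ENNReal.ofReal r := by simpa using hr
  have key : ∀ z : Space N × Space N, ‖φ (a + r • z.1) - φ (a + r • z.2)‖ₑ ^ p /
      ‖z.1 - z.2‖ₑ ^ ((N : ℝ) + s * p) = ENNReal.ofReal r ^ ((N : ℝ) + s * p) *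
      (fun w : Space N × Space N => ‖φ w.1 - φ w.2‖ₑ ^ p /
        ‖w.1 - w.2‖ₑ ^ ((N : ℝ) + s * p)) ((a, a) + r • z) := by
    intro z
    have h1 : ((a, a) + r • z : Space N × Space N) = (a + r • z.1, a + r • z.2) := rfl
    have h2 : ‖(a + r • z.1) - (a + r • z.2)‖ₑ = ENNReal.ofReal r * ‖z.1 - z.2‖ₑ := by
      rw [add_sub_add_left_eq_sub, ← smul_sub, enorm_smul, Real.enorm_of_nonneg hr.le]
    simp only [h1, h2]
    have hc0 : ENNReal.ofReal r ^ ((N : ℝ) + s * p) ≠ 0 := by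
      rw [ENNReal.ofReal_rpow_of_pos hr]; simpa using Real.rpow_pos_of_pos hr _
    have hct : ENNReal.ofReal r ^ ((N : ℝ) + s * p) ≠ ⊤ := by
      rw [ENNReal.ofReal_rpow_of_pos hr]; simp
    have h3 : (ENNReal.ofReal r * ‖z.1 - z.2‖ₑ) ^ ((N : ℝ) + s * p) =
        ENNReal.ofReal r ^ ((N : ℝ) + s * p) * ‖z.1 - z.2‖ₑ ^ ((N : ℝ) + s * p) :=
      ENNReal.mul_rpow_of_ne_top (by simp) (by simp) _
    rw [h3, ← mul_div_assoc, ENNReal.mul_div_mul_left _ _ hc0 hct]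
  have : (volume : Measure (Space N × Space N)).IsAddHaarMeasure :=
    inferInstanceAs (Measure.IsAddHaarMeasure (Measure.prod volume volume))
  have hvol := lintegral_comp_affine (volume : Measure (Space N × Space N))
    (fun w : Space N × Space N => ‖φ w.1 - φ w.2‖ₑ ^ p /
        ‖w.1 - w.2‖ₑ ^ ((N : ℝ) + s * p)) (a, a) hr
  unfold gagliardoSeminorm
  simp_rw [key]
  rw [lintegral_const_mul' _ _ (by rw [ENNReal.ofReal_rpow_of_pos hr]; simp), hvol, ← mul_assoc,
    ENNReal.mul_rpow_of_nonneg _ _ (by positivity)]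
  congr 1
  rw [ENNReal.ofReal_rpow_of_pos hr, ← ENNReal.ofReal_mul (by positivity),
    ENNReal.ofReal_rpow_of_pos (by positivity)]
  congr 1
  have hd : Module.finrank ℝ (Space N × Space N) = N + N := by simp
  rw [hd, ← Real.rpow_natCast, ← Real.rpow_neg hr.le, ← Real.rpow_add hr, ← Real.rpow_mul hr.le,
    holderExponent]
  congr 1
  push_cast
  field_simp
  ring

theorem gradientSeminorm_comp_affine {p : ℝ} (hp : 1 < p) {φ : Space N → ℝ}
    (hφ : ContDiff ℝ 1 φ) (a : Space N) {r : ℝ} (hr : 0 < r) :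
    gradientSeminorm p (fun z => φ (a + r • z)) =
      ENNReal.ofReal (r ^ holderExponent N 1 p) * gradientSeminorm p φ := by
  have hd : ∀ z, fderiv ℝ (fun z => φ (a + r • z)) z = r • fderiv ℝ φ (a + r • z) := by
    intro z
    have h1 : HasFDerivAt (fun z : Space N => a + r • z)
        (r • ContinuousLinearMap.id ℝ (Space N)) z :=
      ((hasFDerivAt_id z).const_smul r).const_add a
    have h2 := ((hφ.differentiable one_ne_zero) (a + r • z)).hasFDerivAt.comp z h1
    refine h2.fderiv.trans ?_
    ext v
    simp
  have h0 : ContDiff ℝ 1 fun z => φ (a + r • z) := by fun_prop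
  rw [gradientSeminorm_of_contDiff h0, gradientSeminorm_of_contDiff hφ]
  have key : ∀ z, ‖fderiv ℝ (fun z => φ (a + r • z)) z‖ₑ ^ p =
      ENNReal.ofReal r ^ p * ‖fderiv ℝ φ (a + r • z)‖ₑ ^ p := by
    intro z
    rw [hd, enorm_smul, Real.enorm_of_nonneg hr.le, ENNReal.mul_rpow_of_nonneg _ _ (by linarith)]
  simp_rw [key]
  rw [lintegral_const_mul' _ _ (by rw [ENNReal.ofReal_rpow_of_pos hr]; simp),
    lintegral_comp_affine volume (fun x => ‖fderiv ℝ φ x‖ₑ ^ p) a hr, ← mul_assoc,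
    ENNReal.mul_rpow_of_nonneg _ _ (by positivity)]
  congr 1
  rw [ENNReal.ofReal_rpow_of_pos hr, ← ENNReal.ofReal_mul (by positivity),
    ENNReal.ofReal_rpow_of_pos (by positivity)]
  congr 1
  rw [finrank_euclideanSpace_fin, ← Real.rpow_natCast, ← Real.rpow_neg hr.le, ← Real.rpow_add hr,
    ← Real.rpow_mul hr.le, holderExponent]
  congr 1
  field_simp
  ring

theorem sobolevSeminorm_comp_affine {s p : ℝ} (hp : 1 < p) {φ : Space N → ℝ}
    (hφ : ContDiff ℝ 1 φ) (a : Space N) {r : ℝ} (hr : 0 < r) :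
    sobolevSeminorm s p (fun z => φ (a + r • z)) =
      ENNReal.ofReal (r ^ holderExponent N s p) * sobolevSeminorm s p φ := by
  unfold sobolevSeminorm
  split_ifs with h
  · rw [h]; exact gradientSeminorm_comp_affine hp hφ a hr
  · exact gagliardoSeminorm_comp_affine hp φ a hr

theorem sobolevSeminorm_le_of_le {s p : ℝ} (hp : 1 < p) {f g : Space N → ℝ}
    (hf : ContDiff ℝ 1 f) (hg : ContDiff ℝ 1 g)
    (h : ∀ x y, |f x - f y| ≤ |g x - g y|) (h' : ∀ x, ‖fderiv ℝ f x‖ ≤ ‖fderiv ℝ g x‖) :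
    sobolevSeminorm s p f ≤ sobolevSeminorm s p g := by
  unfold sobolevSeminorm
  split_ifs with hs
  · rw [gradientSeminorm_of_contDiff hf, gradientSeminorm_of_contDiff hg]
    gcongr with x
    exact enorm_le_iff_norm_le.2 (h' x)
  · unfold gagliardoSeminorm
    gcongr with z
    exact enorm_le_iff_norm_le.2 (h z.1 z.2)

theorem sobolevSeminorm_sub_const {s p : ℝ} (hp : 1 < p) {f : Space N → ℝ}
    (hf : ContDiff ℝ 1 f) (c : ℝ) :
    sobolevSeminorm s p (fun x => f x - c) = sobolevSeminorm s p f := by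
  refine le_antisymm (sobolevSeminorm_le_of_le hp (hf.sub contDiff_const) hf ?_ ?_)
    (sobolevSeminorm_le_of_le hp hf (hf.sub contDiff_const) ?_ ?_) <;> simp [fderiv_sub_const]

theorem sobolevSeminorm_const_mul {s p : ℝ} (hp : 1 < p) {f : Space N → ℝ}
    (hf : ContDiff ℝ 1 f) (c : ℝ) :
    sobolevSeminorm s p (fun x => c * f x) = ‖c‖ₑ * sobolevSeminorm s p f := by
  have hp0 : 0 < p := by linarith
  have hc : ‖c‖ₑ ^ p ≠ ⊤ := by simp [hp0.le]
  have hc' : (‖c‖ₑ ^ p) ^ (1 / p) = ‖c‖ₑ := by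
    rw [← ENNReal.rpow_mul, mul_one_div_cancel hp0.ne', ENNReal.rpow_one]
  unfold sobolevSeminorm
  split_ifs with hs
  · rw [gradientSeminorm_of_contDiff hf, gradientSeminorm_of_contDiff (contDiff_const.mul hf)]
    have : ∀ x, ‖fderiv ℝ (fun x => c * f x) x‖ₑ ^ p = ‖c‖ₑ ^ p * ‖fderiv ℝ f x‖ₑ ^ p := by
      intro x
      rw [fderiv_const_mul ((hf.differentiable one_ne_zero) x), enorm_smul,
        ENNReal.mul_rpow_of_nonneg _ _ hp0.le]
    simp_rw [this]
    rw [lintegral_const_mul' _ _ hc, ENNReal.mul_rpow_of_nonneg _ _ (by positivity), hc']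
  · unfold gagliardoSeminorm
    simp_rw [← mul_sub, enorm_mul, ENNReal.mul_rpow_of_nonneg _ _ hp0.le, mul_div_assoc]
    rw [lintegral_const_mul' _ _ hc, ENNReal.mul_rpow_of_nonneg _ _ (by positivity), hc']

/-! ### Truncations and cut-offs -/

/-- Minkowski's inequality for the two seminorms at once: the differences and the gradient of `f`
are controlled by those of `g` and `h`. -/
theorem sobolevSeminorm_le_add {s p : ℝ} (hp : 1 < p) {f g h : Space N → ℝ}
    (hf : ContDiff ℝ 1 f) (hg : ContDiff ℝ 1 g) (hh : ContDiff ℝ 1 h)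
    (hfgh : ∀ x y, |f x - f y| ≤ |g x - g y| + |h x - h y|)
    (hfgh' : ∀ x, ‖fderiv ℝ f x‖ ≤ ‖fderiv ℝ g x‖ + ‖fderiv ℝ h x‖) :
    sobolevSeminorm s p f ≤ sobolevSeminorm s p g + sobolevSeminorm s p h := by
  have hp0 : 0 < p := by linarith
  unfold sobolevSeminorm
  split_ifs with hs
  · rw [gradientSeminorm_of_contDiff hf, gradientSeminorm_of_contDiff hg,
      gradientSeminorm_of_contDiff hh]
    refine le_trans ?_ (ENNReal.lintegral_Lp_add_le
      (hg.continuous_fderiv one_ne_zero).enorm.aemeasurable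
      (hh.continuous_fderiv one_ne_zero).enorm.aemeasurable hp.le)
    gcongr with x
    simp only [Pi.add_apply, ← ofReal_norm]
    rw [← ENNReal.ofReal_add (norm_nonneg _) (norm_nonneg _)]
    exact ENNReal.ofReal_le_ofReal (hfgh' x)
  · have hq : ∀ (k : Space N → ℝ), gagliardoSeminorm s p k = (∫⁻ z : Space N × Space N,
        (‖k z.1 - k z.2‖ₑ / ‖z.1 - z.2‖ₑ ^ (((N : ℝ) + s * p) / p)) ^ p) ^ (1 / p) := by
      intro k
      simp_rw [ENNReal.div_rpow_of_nonneg _ _ hp0.le, ← ENNReal.rpow_mul,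
        div_mul_cancel₀ _ hp0.ne']
      rfl
    have hm : ∀ {k : Space N → ℝ}, ContDiff ℝ 1 k → AEMeasurable fun z : Space N × Space N =>
        ‖k z.1 - k z.2‖ₑ / ‖z.1 - z.2‖ₑ ^ (((N : ℝ) + s * p) / p) := fun {k} hk => by
      have := hk.continuous.measurable
      fun_prop
    rw [hq f, hq g, hq h]
    refine le_trans ?_ (ENNReal.lintegral_Lp_add_le (hm hg) (hm hh) hp.le)
    gcongr with z
    simp only [Pi.add_apply, ← ENNReal.add_div]
    gcongr
    simp only [← ofReal_norm]
    rw [← ENNReal.ofReal_add (norm_nonneg _) (norm_nonneg _)]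
    exact ENNReal.ofReal_le_ofReal (hfgh z.1 z.2)

theorem sobolevSeminorm_mul_le {s p : ℝ} (hp : 1 < p) {f η : Space N → ℝ}
    (hf : ContDiff ℝ 1 f) (hη : ContDiff ℝ 1 η) {M : ℝ} (hM : ∀ x, |f x| ≤ M)
    (h1 : ∀ x, |η x| ≤ 1) : sobolevSeminorm s p (fun x => f x * η x) ≤
      sobolevSeminorm s p f + ‖M‖ₑ * sobolevSeminorm s p η := by
  have hM0 : 0 ≤ M := (abs_nonneg _).trans (hM 0)
  rw [← sobolevSeminorm_const_mul hp hη]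
  refine sobolevSeminorm_le_add hp (hf.mul hη) hf (contDiff_const.mul hη) (fun x y => ?_)
    fun x => ?_
  · have e : f x * η x - f y * η y = (f x - f y) * η x + f y * (η x - η y) := by ring
    rw [e, ← mul_sub, abs_mul M, abs_of_nonneg hM0]
    refine (abs_add_le _ _).trans (add_le_add ?_ ?_) <;> rw [abs_mul]
    · exact mul_le_of_le_one_right (abs_nonneg _) (h1 x)
    · exact mul_le_mul_of_nonneg_right (hM y) (abs_nonneg _)
  · have hf' := (hf.differentiable one_ne_zero) x
    have hη' := (hη.differentiable one_ne_zero) x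
    rw [fderiv_fun_mul hf' hη', fderiv_const_mul hη', add_comm]
    refine (norm_add_le _ _).trans (add_le_add ?_ ?_) <;> rw [norm_smul]
    · exact mul_le_of_le_one_left (norm_nonneg _) (h1 x)
    · rw [norm_smul, Real.norm_of_nonneg hM0]
      exact mul_le_mul_of_nonneg_right (hM x) (norm_nonneg _)

theorem sobolevSeminorm_mul_sin_le {s p : ℝ} (hp : 1 < p) {f : Space N → ℝ}
    (hf : ContDiff ℝ 1 f) {M : ℝ} (hM : 0 < M) :
    sobolevSeminorm s p (fun x => M * Real.sin (f x / M)) ≤ sobolevSeminorm s p f := by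
  have hs : ContDiff ℝ 1 fun x => M * Real.sin (f x / M) :=
    contDiff_const.mul (Real.contDiff_sin.comp (hf.div_const M))
  have hL : LipschitzWith 1 Real.sin := lipschitzWith_of_nnnorm_deriv_le Real.differentiable_sin
    fun x => by
      rw [Real.deriv_sin, ← NNReal.coe_le_coe, coe_nnnorm]
      exact Real.abs_cos_le_one x
  refine sobolevSeminorm_le_of_le hp hs hf (fun x y => ?_) fun x => ?_
  · have h := hL.dist_le_mul (f x / M) (f y / M)
    rw [Real.dist_eq, Real.dist_eq, ← sub_div, abs_div, abs_of_pos hM, NNReal.coe_one,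
      one_mul, le_div_iff₀ hM] at h
    rwa [← mul_sub, abs_mul, abs_of_pos hM, mul_comm]
  · have h1 : HasFDerivAt (fun x => f x / M) (M⁻¹ • fderiv ℝ f x) x := by
      simpa only [div_eq_inv_mul, smul_eq_mul] using
        ((hf.differentiable one_ne_zero) x).hasFDerivAt.const_mul M⁻¹
    have h2 := (h1.sin.const_mul M).fderiv
    rw [h2, norm_smul, norm_smul, norm_smul, norm_inv, mul_left_comm, ← mul_assoc ‖M‖,
      mul_inv_cancel₀ (norm_ne_zero_iff.2 hM.ne'), one_mul]
    exact mul_le_of_le_one_left (norm_nonneg _) (Real.abs_cos_le_one _)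

/-! ### Test functions have finite seminorms -/

theorem exists_abs_sub_le_min {η : Space N → ℝ} (hη : η ∈ TestFun N) :
    ∃ C : ℝ, 0 ≤ C ∧ ∀ x y, |η x - η y| ≤ C * min ‖x - y‖ 1 := by
  obtain ⟨K, hK⟩ := ContDiff.lipschitzWith_of_hasCompactSupport hη.2 hη.1 (by simp)
  obtain ⟨B, hB⟩ := hη.2.exists_bound_of_continuous hη.1.continuous
  have hB0 : 0 ≤ B := (norm_nonneg _).trans (hB 0)
  refine ⟨K + 2 * B, by positivity, fun x y => ?_⟩
  have h1 := hK.dist_le_mul x y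
  rw [Real.dist_eq, dist_eq_norm] at h1
  have h2 : |η x - η y| ≤ 2 * B := by
    have := abs_sub (η x) (η y)
    have := hB x; have := hB y
    simp only [Real.norm_eq_abs] at *
    linarith
  have hK0 : (0 : ℝ) ≤ K := K.2
  rcases le_total ‖x - y‖ 1 with h | h
  · rw [min_eq_left h]
    nlinarith [mul_nonneg hB0 (norm_nonneg (x - y))]
  · rw [min_eq_right h]
    linarith

theorem holderSeminorm_lt_top_of_mem_testFun {α : ℝ} (h0 : 0 < α) (h1 : α < 1)
    {η : Space N → ℝ} (hη : η ∈ TestFun N) : holderSeminorm α η < ⊤ := by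
  obtain ⟨C, hC0, hC⟩ := exists_abs_sub_le_min hη
  refine lt_of_le_of_lt (b := ENNReal.ofReal C) ?_ ENNReal.ofReal_lt_top
  refine iSup_le fun x => iSup_le fun y => iSup_le fun hxy => ?_
  have hr : 0 < ‖x - y‖ := norm_pos_iff.2 (sub_ne_zero.2 hxy)
  rw [← ofReal_norm (x - y), ENNReal.ofReal_rpow_of_pos hr, ← ofReal_norm (η x - η y)]
  refine ENNReal.div_le_of_le_mul ?_
  rw [← ENNReal.ofReal_mul hC0]
  refine ENNReal.ofReal_le_ofReal ((hC x y).trans (mul_le_mul_of_nonneg_left ?_ hC0))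
  rcases le_total ‖x - y‖ 1 with h | h
  · rw [min_eq_left h]
    simpa using Real.rpow_le_rpow_of_exponent_ge hr h h1.le
  · rw [min_eq_right h]
    exact Real.one_le_rpow h h0.le

/-- The radial kernel `min(|h|, 1) ^ p / |h| ^ (N + s p)` is integrable: at the origin because
`s < 1`, at infinity because `0 < s`. -/
theorem integrable_min_norm_rpow_div (hN : 1 ≤ N) {s p : ℝ} (hs0 : 0 < s) (hs1 : s < 1)
    (hp : 1 < p) :
    Integrable fun h : Space N => min ‖h‖ 1 ^ p / ‖h‖ ^ ((N : ℝ) + s * p) := by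
  have : Nonempty (Fin N) := ⟨⟨0, hN⟩⟩
  rw [integrable_fun_norm_addHaar volume (f := fun r : ℝ => min r 1 ^ p / r ^ ((N : ℝ) + s * p))]
  have e : ∀ r : ℝ, 0 < r → ∀ t : ℝ, r ^ (Module.finrank ℝ (Space N) - 1) •
      (r ^ t / r ^ ((N : ℝ) + s * p)) = r ^ (t - 1 - s * p) := by
    intro r hr t
    rw [finrank_euclideanSpace_fin, ← Real.rpow_natCast, ← Real.rpow_sub hr, smul_eq_mul,
      ← Real.rpow_add hr, Nat.cast_sub hN]
    congr 1
    push_cast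
    ring
  rw [← Set.Ioc_union_Ioi_eq_Ioi zero_le_one]
  refine IntegrableOn.union ?_ ?_
  · have h : IntegrableOn (fun r : ℝ => r ^ (p - 1 - s * p)) (Set.Ioc 0 1) :=
      (intervalIntegrable_iff_integrableOn_Ioc_of_le zero_le_one).1
        (intervalIntegral.intervalIntegrable_rpow' (by nlinarith))
    refine h.congr_fun (fun r hr => ?_) measurableSet_Ioc
    simp only
    rw [min_eq_left hr.2, e r hr.1]
  · have h : IntegrableOn (fun r : ℝ => r ^ ((0 : ℝ) - 1 - s * p)) (Set.Ioi 1) :=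
      integrableOn_Ioi_rpow_of_lt (by nlinarith) one_pos
    refine h.congr_fun (fun r hr => ?_) measurableSet_Ioi
    have hr' : (1 : ℝ) < r := hr
    simp only
    rw [← e r (by linarith) 0, min_eq_right hr'.le, Real.one_rpow, Real.rpow_zero]

theorem gagliardoSeminorm_lt_top_of_mem_testFun (hN : 1 ≤ N) {s p : ℝ} (hs0 : 0 < s)
    (hs1 : s < 1) (hp : 1 < p) {η : Space N → ℝ} (hη : η ∈ TestFun N) :
    gagliardoSeminorm s p η < ⊤ := by
  have hp0 : 0 < p := by linarith
  obtain ⟨C, hC0, hC⟩ := exists_abs_sub_le_min hη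
  set S : Set (Space N) := tsupport η
  set k : Space N → ℝ≥0∞ := fun h =>
    ENNReal.ofReal (C ^ p) * ENNReal.ofReal (min ‖h‖ 1 ^ p / ‖h‖ ^ ((N : ℝ) + s * p))
  have hkm : Measurable k := by
    unfold k
    fun_prop
  have hk : ∫⁻ h, k h < ⊤ := by
    unfold k
    rw [lintegral_const_mul' _ _ ENNReal.ofReal_ne_top]
    exact ENNReal.mul_lt_top ENNReal.ofReal_lt_top
      (integrable_min_norm_rpow_div hN hs0 hs1 hp).lintegral_lt_top
  have hS : MeasurableSet S := (isClosed_tsupport η).measurableSet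
  have hSv : volume S < ⊤ := hη.2.measure_lt_top
  -- A nonzero difference forces one of the two points into the support.
  have hle : ∀ z : Space N × Space N, ‖η z.1 - η z.2‖ₑ ^ p / ‖z.1 - z.2‖ₑ ^ ((N : ℝ) + s * p) ≤
      S.indicator 1 z.1 * k (z.1 - z.2) + S.indicator 1 z.2 * k (z.1 - z.2) := by
    rintro ⟨x, y⟩
    rw [← add_mul]
    by_cases hxy : x = y
    · simp [hxy, ENNReal.zero_rpow_of_pos hp0]
    have hr : 0 < ‖x - y‖ := norm_pos_iff.2 (sub_ne_zero.2 hxy)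
    by_cases hx : x ∉ S ∧ y ∉ S
    · have h1 : η x = 0 := image_eq_zero_of_notMem_tsupport hx.1
      have h2 : η y = 0 := image_eq_zero_of_notMem_tsupport hx.2
      simp [h1, h2, ENNReal.zero_rpow_of_pos hp0]
    have h1 : (1 : ℝ≥0∞) ≤ S.indicator 1 x + S.indicator 1 y := by
      by_cases hxS : x ∈ S
      · simp [hxS]
      · have : y ∈ S := by tauto
        simp [this]
    refine le_trans ?_ (le_mul_of_one_le_left' h1)
    simp only [k]
    have hmin : 0 ≤ min ‖x - y‖ 1 := by positivity
    rw [← ENNReal.ofReal_mul (by positivity), ← ofReal_norm (x - y),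
      ← ofReal_norm (η x - η y), ENNReal.ofReal_rpow_of_pos hr,
      ENNReal.ofReal_rpow_of_nonneg (norm_nonneg _) hp0.le,
      ← ENNReal.ofReal_div_of_pos (by positivity), ← mul_div_assoc, ← Real.mul_rpow hC0 hmin]
    refine ENNReal.ofReal_le_ofReal ?_
    gcongr
    exact hC x y
  have hi : Measurable (S.indicator (1 : Space N → ℝ≥0∞)) := measurable_one.indicator hS
  have hS1 : ∫⁻ x, S.indicator (1 : Space N → ℝ≥0∞) x = volume S := lintegral_indicator_one hS
  have hA : ∫⁻ z : Space N × Space N, S.indicator 1 z.1 * k (z.1 - z.2) =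
      volume S * ∫⁻ h, k h := by
    rw [Measure.volume_eq_prod, lintegral_prod _ (by fun_prop)]
    have h (x : Space N) : ∫⁻ y, S.indicator 1 x * k (x - y) =
        S.indicator 1 x * ∫⁻ h, k h := by
      rw [lintegral_const_mul _ (by fun_prop), lintegral_sub_left_eq_self k]
    simp_rw [h]
    rw [lintegral_mul_const _ hi, hS1]
  have hB : ∫⁻ z : Space N × Space N, S.indicator 1 z.2 * k (z.1 - z.2) =
      volume S * ∫⁻ h, k h := by
    rw [Measure.volume_eq_prod, lintegral_prod_symm _ (by fun_prop)]
    have h (y : Space N) : ∫⁻ x, S.indicator 1 y * k (x - y) =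
        S.indicator 1 y * ∫⁻ h, k h := by
      rw [lintegral_const_mul _ (by fun_prop), lintegral_sub_right_eq_self k]
    simp_rw [h]
    rw [lintegral_mul_const _ hi, hS1]
  refine ENNReal.rpow_lt_top_of_nonneg (by positivity) (ne_of_lt ?_)
  refine (lintegral_mono hle).trans_lt ?_
  rw [lintegral_add_left (by fun_prop), hA, hB]
  exact ENNReal.add_lt_top.2 ⟨ENNReal.mul_lt_top hSv hk, ENNReal.mul_lt_top hSv hk⟩

theorem gradientSeminorm_lt_top_of_mem_testFun {p : ℝ} (hp : 1 < p) {η : Space N → ℝ}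
    (hη : η ∈ TestFun N) : gradientSeminorm p η < ⊤ := by
  have hp0 : 0 < p := by linarith
  rw [gradientSeminorm_of_contDiff (hη.1.of_le (by simp))]
  have h := ((hη.1.continuous_fderiv (by simp)).memLp_of_hasCompactSupport (p := ENNReal.ofReal p)
    (μ := volume) (hη.2.fderiv ℝ)).eLpNorm_lt_top
  rwa [eLpNorm_eq_lintegral_rpow_enorm_toReal (by simpa using hp0) (by simp),
    ENNReal.toReal_ofReal hp0.le] at h

theorem sobolevSeminorm_lt_top_of_mem_testFun (hN : 1 ≤ N) {s p : ℝ} (hs0 : 0 < s) (hs1 : s ≤ 1)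
    (hp : 1 < p) {η : Space N → ℝ} (hη : η ∈ TestFun N) : sobolevSeminorm s p η < ⊤ := by
  unfold sobolevSeminorm
  split_ifs with hs
  · exact gradientSeminorm_lt_top_of_mem_testFun hp hη
  · exact gagliardoSeminorm_lt_top_of_mem_testFun hN hs0 (lt_of_le_of_ne hs1 hs) hp hη

/-! ### Mollification does not increase the Sobolev seminorm -/

/-- Jensen's inequality for the average of `v` with respect to the probability density `ρ`. -/
theorem enorm_integral_smul_rpow_le {X F : Type*} [MeasurableSpace X] {μ : Measure X}
    [NormedAddCommGroup F] [NormedSpace ℝ F] {p : ℝ} (hp : 1 ≤ p) {ρ : X → ℝ}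
    (hρm : AEMeasurable ρ μ) (hρ : ∫⁻ t, ‖ρ t‖ₑ ∂μ = 1) {v : X → F}
    (hv : AEStronglyMeasurable v μ) :
    ‖∫ t, ρ t • v t ∂μ‖ₑ ^ p ≤ ∫⁻ t, ‖ρ t‖ₑ * ‖v t‖ₑ ^ p ∂μ := by
  have hp0 : 0 < p := by linarith
  set ν := μ.withDensity fun t => ‖ρ t‖ₑ
  have hν : IsProbabilityMeasure ν := ⟨by simp [ν, hρ]⟩
  have hd : ∀ w : X → ℝ≥0∞, AEMeasurable w μ → ∫⁻ t, ‖ρ t‖ₑ * w t ∂μ = ∫⁻ t, w t ∂ν :=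
    fun w hw => (lintegral_withDensity_eq_lintegral_mul₀ hρm.enorm hw).symm
  have h1 : ‖∫ t, ρ t • v t ∂μ‖ₑ ≤ ∫⁻ t, ‖v t‖ₑ ∂ν := by
    refine (enorm_integral_le_lintegral_enorm _).trans ?_
    simp_rw [enorm_smul]
    exact (hd _ hv.enorm).le
  have h2 := eLpNorm'_le_eLpNorm'_of_exponent_le one_pos hp ν
    (hv.mono_ac (withDensity_absolutelyContinuous μ _))
  simp only [eLpNorm', ENNReal.rpow_one, div_one] at h2
  rw [hd _ (hv.enorm.pow_const p)]
  have h3 := ENNReal.rpow_le_rpow (h1.trans h2) hp0.le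
  rwa [← ENNReal.rpow_mul, one_div_mul_cancel hp0.ne', ENNReal.rpow_one] at h3

/-- The average of `u` against the normalised bump `ρ` centred at the origin. -/
noncomputable def mollify (ρ : ContDiffBump (0 : Space N)) (u : Space N → ℝ) : Space N → ℝ :=
  convolution (ρ.normed volume) u (ContinuousLinearMap.lsmul ℝ ℝ) volume

section mollify

variable (ρ : ContDiffBump (0 : Space N)) {u : Space N → ℝ}

theorem mollify_apply (x : Space N) : mollify ρ u x = ∫ t, ρ.normed volume t • u (x - t) := rfl

theorem contDiff_mollify (hu : LocallyIntegrable u) : ContDiff ℝ ∞ (mollify ρ u) :=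
  ρ.hasCompactSupport_normed.contDiff_convolution_left _ ρ.contDiff_normed hu

theorem lintegral_enorm_normed : ∫⁻ t, ‖ρ.normed volume t‖ₑ = 1 := by
  have h := ofReal_integral_eq_lintegral_ofReal (μ := volume) ρ.integrable_normed
    (.of_forall ρ.nonneg_normed)
  rw [ρ.integral_normed, ENNReal.ofReal_one] at h
  rw [h]
  exact lintegral_congr fun t => Real.enorm_of_nonneg (ρ.nonneg_normed t)

theorem gagliardoSeminorm_mollify_le {s p : ℝ} (hp : 1 < p) (hu : Continuous u) :
    gagliardoSeminorm s p (mollify ρ u) ≤ gagliardoSeminorm s p u := by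
  have hp0 : 0 < p := by linarith
  set F : Space N × Space N → ℝ≥0∞ := fun z =>
    ‖u z.1 - u z.2‖ₑ ^ p / ‖z.1 - z.2‖ₑ ^ ((N : ℝ) + s * p) with hF
  have hum := hu.measurable
  have hFm : Measurable F := by unfold F; fun_prop
  have hρm : Measurable (ρ.normed (volume : Measure (Space N))) :=
    (ρ.contDiff_normed (n := 0)).continuous.measurable
  have hi : ∀ x, Integrable fun t => ρ.normed volume t • u (x - t) := fun x =>
    ((ρ.contDiff_normed (n := 0)).continuous.smul
      (hu.comp (continuous_const.sub continuous_id))).integrable_of_hasCompactSupport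
      ρ.hasCompactSupport_normed.smul_right
  have hpt : ∀ z : Space N × Space N,
      ‖mollify ρ u z.1 - mollify ρ u z.2‖ₑ ^ p / ‖z.1 - z.2‖ₑ ^ ((N : ℝ) + s * p) ≤
        ∫⁻ t, ‖ρ.normed volume t‖ₑ * F (z - (t, t)) := by
    intro z
    have h1 : mollify ρ u z.1 - mollify ρ u z.2 =
        ∫ t, ρ.normed volume t • (u (z.1 - t) - u (z.2 - t)) := by
      rw [mollify_apply, mollify_apply, ← integral_sub (hi _) (hi _)]
      simp_rw [smul_sub]
    have h2 := enorm_integral_smul_rpow_le hp.le hρm.aemeasurable (lintegral_enorm_normed ρ)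
      (v := fun t => u (z.1 - t) - u (z.2 - t))
      ((by fun_prop : Continuous fun t => u (z.1 - t) - u (z.2 - t)).aestronglyMeasurable)
    rw [h1]
    refine (ENNReal.div_le_div_right h2 _).trans (le_of_eq ?_)
    rw [div_eq_mul_inv, ← lintegral_mul_const _ (by fun_prop)]
    refine lintegral_congr fun t => ?_
    simp only [hF, Prod.fst_sub, Prod.snd_sub, sub_sub_sub_cancel_right, div_eq_mul_inv, mul_assoc]
  unfold gagliardoSeminorm
  gcongr ?_ ^ _
  refine (lintegral_mono hpt).trans (le_of_eq ?_)
  have : (volume : Measure (Space N × Space N)).IsAddHaarMeasure :=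
    inferInstanceAs (Measure.IsAddHaarMeasure (Measure.prod volume volume))
  rw [lintegral_lintegral_swap (by fun_prop)]
  have h3 (t : Space N) : ∫⁻ z, ‖ρ.normed volume t‖ₑ * F (z - (t, t)) =
      ‖ρ.normed volume t‖ₑ * ∫⁻ z, F z := by
    rw [lintegral_const_mul _ (by fun_prop), lintegral_sub_right_eq_self F]
  simp_rw [h3]
  rw [lintegral_mul_const _ (by fun_prop), lintegral_enorm_normed, one_mul]

/-- The gradient of the mollification is the mollification of the weak gradient. -/
theorem gradient_mollify {G : Space N → Space N} (hG : IsWeakGradient u G) (x : Space N) :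
    gradient (mollify ρ u) x = ∫ t, ρ.normed volume t • G (x - t) := by
  have hρs : ContDiff ℝ ∞ (ρ.normed (volume : Measure (Space N))) := ρ.contDiff_normed
  have hρc : HasCompactSupport (ρ.normed (volume : Measure (Space N))) :=
    ρ.hasCompactSupport_normed
  have hψs : ContDiff ℝ ∞ fun y => ρ.normed volume (x - y) :=
    hρs.comp (contDiff_const.sub contDiff_id)
  have hψc : HasCompactSupport fun y => ρ.normed volume (x - y) :=
    hρc.comp_homeomorph (Homeomorph.subLeft x)
  have hψd : ∀ y v, fderiv ℝ (fun y => ρ.normed volume (x - y)) y v =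
      -fderiv ℝ (ρ.normed volume) (x - y) v := by
    intro y v
    have h1 : HasFDerivAt (fun y : Space N => x - y) (-ContinuousLinearMap.id ℝ (Space N)) y :=
      (hasFDerivAt_id y).const_sub x
    have h2 := ((hρs.differentiable (by simp)) (x - y)).hasFDerivAt.comp y h1
    have h3 : fderiv ℝ (fun y => ρ.normed volume (x - y)) y =
        (fderiv ℝ (ρ.normed volume) (x - y)).comp (-ContinuousLinearMap.id ℝ (Space N)) := h2.fderiv
    rw [h3]
    simp
  refine ext_inner_right ℝ fun v => ?_
  have hL : inner ℝ (gradient (mollify ρ u) x) v = fderiv ℝ (mollify ρ u) x v := by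
    rw [gradient, InnerProductSpace.toDual_symm_apply]
  have hd : fderiv ℝ (mollify ρ u) x =
      ∫ t, (fderiv ℝ (ρ.normed volume) t).smulRight (u (x - t)) := by
    have h := (hρc.hasFDerivAt_convolution_left (ContinuousLinearMap.lsmul ℝ ℝ) ρ.contDiff_normed
      hG.locallyIntegrable x).fderiv
    refine h.trans (integral_congr_ae (.of_forall fun t => ?_))
    ext w
    simp [ContinuousLinearMap.precompL_apply]
  have hc : fderiv ℝ (mollify ρ u) x =
      ∫ y, (fderiv ℝ (ρ.normed volume) (x - y)).smulRight (u y) := by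
    rw [hd, ← integral_sub_left_eq_self _ volume x]
    simp
  have hi : Integrable fun y => (fderiv ℝ (ρ.normed volume) (x - y)).smulRight (u y) := by
    have hcs : HasCompactSupport fun y => fderiv ℝ (ρ.normed volume) (x - y) :=
      (hρc.fderiv ℝ).comp_homeomorph (Homeomorph.subLeft x)
    have hcc : Continuous fun y => fderiv ℝ (ρ.normed volume) (x - y) :=
      (hρs.continuous_fderiv (by simp)).comp (continuous_const.sub continuous_id)
    have := hG.locallyIntegrable.integrable_smul_right_of_hasCompactSupport hcc hcs
    refine this.congr (.of_forall fun y => ?_)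
    ext w
    simp [mul_comm]
  have hiG : Integrable fun y => ρ.normed volume (x - y) • G y :=
    hG.locallyIntegrable_grad.integrable_smul_left_of_hasCompactSupport hψs.continuous hψc
  have hR : ∫ t, ρ.normed volume t • G (x - t) = ∫ y, ρ.normed volume (x - y) • G y := by
    rw [← integral_sub_left_eq_self _ volume x]
    simp
  rw [hL, hc, hR, ContinuousLinearMap.integral_apply hi, real_inner_comm, ← integral_inner hiG]
  have h := hG.integral_eq _ ⟨hψs, hψc⟩ v
  simp_rw [hψd, mul_neg, integral_neg, neg_inj] at h
  simp only [ContinuousLinearMap.smulRight_apply, smul_eq_mul, inner_smul_right]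
  refine (integral_congr_ae (.of_forall fun y => ?_)).trans (h.trans ?_)
  · exact mul_comm _ _
  · simp_rw [real_inner_comm]

theorem gradientSeminorm_mollify_le {p : ℝ} (hp : 1 < p) :
    gradientSeminorm p (mollify ρ u) ≤ gradientSeminorm p u := by
  refine le_iInf₂ fun G hG => ?_
  have hs : ContDiff ℝ 1 (mollify ρ u) := (contDiff_mollify ρ hG.locallyIntegrable).of_le (by simp)
  rw [(isWeakGradient_gradient hs).gradientSeminorm_eq]
  gcongr ?_ ^ _
  have hρm : Measurable (ρ.normed (volume : Measure (Space N))) :=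
    (ρ.contDiff_normed (n := 0)).continuous.measurable
  have hGm := hG.locallyIntegrable_grad.aestronglyMeasurable
  have hGx (x : Space N) : AEStronglyMeasurable (fun t => G (x - t)) :=
    hGm.comp_quasiMeasurePreserving (quasiMeasurePreserving_sub_left_of_right_invariant volume x)
  have hG2 : AEStronglyMeasurable (fun z : Space N × Space N => G (z.1 - z.2))
      (Measure.prod volume volume) :=
    hGm.comp_quasiMeasurePreserving (quasiMeasurePreserving_sub_of_right_invariant volume volume)
  calc ∫⁻ x, ‖gradient (mollify ρ u) x‖ₑ ^ p
      ≤ ∫⁻ x, ∫⁻ t, ‖ρ.normed volume t‖ₑ * ‖G (x - t)‖ₑ ^ p := by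
        refine lintegral_mono fun x => ?_
        rw [gradient_mollify ρ hG]
        exact enorm_integral_smul_rpow_le hp.le hρm.aemeasurable (lintegral_enorm_normed ρ) (hGx x)
    _ = ∫⁻ t, ∫⁻ x, ‖ρ.normed volume t‖ₑ * ‖G (x - t)‖ₑ ^ p := by
        refine lintegral_lintegral_swap ?_
        exact (hρm.comp measurable_snd).enorm.aemeasurable.mul (hG2.enorm.pow_const p)
    _ = ∫⁻ t, ‖ρ.normed volume t‖ₑ * ∫⁻ x, ‖G x‖ₑ ^ p := by
        refine lintegral_congr fun t => ?_
        rw [lintegral_const_mul' _ _ enorm_ne_top,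
          lintegral_sub_right_eq_self fun x => ‖G x‖ₑ ^ p]
    _ = ∫⁻ x, ‖G x‖ₑ ^ p := by
        rw [lintegral_mul_const _ (by fun_prop), lintegral_enorm_normed, one_mul]

theorem sobolevSeminorm_mollify_le {s p : ℝ} (hp : 1 < p) (hu : Continuous u) :
    sobolevSeminorm s p (mollify ρ u) ≤ sobolevSeminorm s p u := by
  unfold sobolevSeminorm
  split_ifs
  · exact gradientSeminorm_mollify_le ρ hp
  · exact gagliardoSeminorm_mollify_le ρ hp hu

end mollify

/-! ### The sharp Morrey inequality for continuous functions -/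

theorem holderExponent_pos {s p : ℝ} (hp : 1 < p) (hsp : (N : ℝ) < s * p) :
    0 < holderExponent N s p := by
  have : (N : ℝ) / p < s := by rwa [div_lt_iff₀ (by linarith)]
  unfold holderExponent
  linarith

theorem holderExponent_lt_one (hN : 1 ≤ N) {s p : ℝ} (hs1 : s ≤ 1) (hp : 1 < p) :
    holderExponent N s p < 1 := by
  have h1 : (0 : ℝ) < N := by exact_mod_cast hN
  have : 0 < (N : ℝ) / p := div_pos h1 (by linarith)
  unfold holderExponent
  linarith

theorem enorm_sub_le_holderSeminorm_mul {α : ℝ} (hα : 0 < α) (f : Space N → ℝ) (x y : Space N) :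
    ‖f x - f y‖ₑ ≤ holderSeminorm α f * ‖x - y‖ₑ ^ α := by
  by_cases hxy : x = y
  · simp [hxy]
  have h0 : ‖x - y‖ₑ ≠ 0 := by simpa [sub_eq_zero] using hxy
  rw [← ENNReal.div_le_iff_le_mul (.inl (by simp [ENNReal.rpow_eq_zero_iff, h0]))
    (.inl (by simp [hα.le]))]
  exact le_iSup_of_le x (le_iSup_of_le y (le_iSup_of_le hxy le_rfl))

theorem holderSeminorm_le {α : ℝ} {f : Space N → ℝ} {K : ℝ≥0∞}
    (h : ∀ x y, ‖f x - f y‖ₑ ≤ K * ‖x - y‖ₑ ^ α) : holderSeminorm α f ≤ K :=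
  iSup_le fun x => iSup_le fun y => iSup_le fun _ => ENNReal.div_le_of_le_mul (h x y)

theorem mul_holderSeminorm_le {α : ℝ} {f : Space N → ℝ} {c K : ℝ≥0∞}
    (h : ∀ x y, c * ‖f x - f y‖ₑ ≤ K * ‖x - y‖ₑ ^ α) : c * holderSeminorm α f ≤ K := by
  simp_rw [holderSeminorm, ENNReal.mul_iSup, ← mul_div_assoc]
  exact iSup_le fun x => iSup_le fun y => iSup_le fun _ => ENNReal.div_le_of_le_mul (h x y)

theorem holderSeminorm_const_mul (α c : ℝ) (f : Space N → ℝ) :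
    holderSeminorm α (fun x => c * f x) = ‖c‖ₑ * holderSeminorm α f := by
  simp_rw [holderSeminorm, ENNReal.mul_iSup, ← mul_sub, enorm_mul, mul_div_assoc]

theorem TestFun.const_mul {f : Space N → ℝ} (hf : f ∈ TestFun N) (c : ℝ) :
    (fun x => c * f x) ∈ TestFun N :=
  ⟨contDiff_const.mul hf.1, hf.2.mul_left⟩

theorem TestFun.contDiff_one {f : Space N → ℝ} (hf : f ∈ TestFun N) : ContDiff ℝ 1 f :=
  hf.1.of_le (by simp)

/-- A test function rescaled so as to have Hölder seminorm one. -/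
theorem exists_normalized_testFun {s p : ℝ} (hp : 1 < p) {α : ℝ} (h0 : 0 < α) (h1 : α < 1)
    {f : Space N → ℝ} (hf : f ∈ TestFun N) {x y : Space N} (hxy : f x ≠ f y) :
    ∃ g ∈ TestFun N, holderSeminorm α g = 1 ∧
      sobolevSeminorm s p g * holderSeminorm α f = sobolevSeminorm s p f := by
  have ht : holderSeminorm α f ≠ ⊤ := (holderSeminorm_lt_top_of_mem_testFun h0 h1 hf).ne
  have hz : holderSeminorm α f ≠ 0 := by
    intro h
    have := enorm_sub_le_holderSeminorm_mul h0 f x y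
    rw [h, zero_mul, nonpos_iff_eq_zero, enorm_eq_zero, sub_eq_zero] at this
    exact hxy this
  have hpos : 0 < (holderSeminorm α f).toReal := ENNReal.toReal_pos hz ht
  have hc : ‖((holderSeminorm α f).toReal)⁻¹‖ₑ = (holderSeminorm α f)⁻¹ := by
    rw [Real.enorm_of_nonneg (by positivity), ENNReal.ofReal_inv_of_pos hpos,
      ENNReal.ofReal_toReal ht]
  refine ⟨fun x => ((holderSeminorm α f).toReal)⁻¹ * f x, TestFun.const_mul hf _, ?_, ?_⟩
  · rw [holderSeminorm_const_mul, hc, ENNReal.inv_mul_cancel hz ht]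
  · rw [sobolevSeminorm_const_mul hp (TestFun.contDiff_one hf), hc, mul_right_comm,
      ENNReal.inv_mul_cancel hz ht, one_mul]

theorem exists_testFun_ne (hN : 1 ≤ N) : ∃ f ∈ TestFun N, ∃ x y, f x ≠ f y := by
  have : Nonempty (Fin N) := ⟨⟨0, hN⟩⟩
  let η : ContDiffBump (0 : Space N) := ⟨1, 2, one_pos, one_lt_two⟩
  refine ⟨η, ⟨η.contDiff, η.hasCompactSupport⟩, 0, EuclideanSpace.single ⟨0, hN⟩ 3, ?_⟩
  have h1 : η 0 = 1 := η.one_of_mem_closedBall (by simp [η])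
  have h2 : η (EuclideanSpace.single ⟨0, hN⟩ 3) = 0 :=
    η.zero_of_le_dist (by simp [η]; norm_num)
  rw [h1, h2]
  exact one_ne_zero

theorem morreyConstant_lt_top (hN : 1 ≤ N) {s p : ℝ} (hs0 : 0 < s) (hs1 : s ≤ 1) (hp : 1 < p)
    (hsp : (N : ℝ) < s * p) : morreyConstant N s p < ⊤ := by
  obtain ⟨f, hf, x, y, hxy⟩ := exists_testFun_ne hN
  obtain ⟨g, hg, hg1, -⟩ := exists_normalized_testFun (s := s) hp (holderExponent_pos hp hsp)
    (holderExponent_lt_one hN hs1 hp) hf hxy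
  refine lt_of_le_of_lt (iInf₂_le_of_le g hg (iInf_le _ hg1)) ?_
  exact ENNReal.rpow_lt_top_of_nonneg (by linarith)
    (sobolevSeminorm_lt_top_of_mem_testFun hN hs0 hs1 hp hg).ne

/-- `c` is an admissible constant in Morrey's inequality for `f`, written without division. -/
def MorreyBound (s p : ℝ) (c : ℝ≥0∞) (f : Space N → ℝ) : Prop :=
  ∀ x y, c * ‖f x - f y‖ₑ ≤ sobolevSeminorm s p f * ‖x - y‖ₑ ^ holderExponent N s p

theorem MorreyBound.of_tendsto {s p : ℝ} (hα : 0 < holderExponent N s p) {c : ℝ≥0∞} (hc : c ≠ ⊤)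
    {f : ℕ → Space N → ℝ} {g : Space N → ℝ} (hf : ∀ n, MorreyBound s p c (f n))
    (hfg : ∀ x, Tendsto (fun n => f n x) atTop (𝓝 (g x))) {S : ℕ → ℝ≥0∞}
    (hS : ∀ n, sobolevSeminorm s p (f n) ≤ S n)
    (hSg : Tendsto S atTop (𝓝 (sobolevSeminorm s p g))) : MorreyBound s p c g := by
  intro x y
  refine le_of_tendsto_of_tendsto' (ENNReal.Tendsto.const_mul
    ((hfg x).sub (hfg y)).enorm (.inr hc)) (ENNReal.Tendsto.mul_const hSg
    (.inr (by simp [hα.le]))) fun n => (hf n x y).trans ?_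
  gcongr
  exact hS n

theorem morreyBound_of_mem_testFun (hN : 1 ≤ N) {s p : ℝ} (hs1 : s ≤ 1) (hp : 1 < p)
    (hsp : (N : ℝ) < s * p) {f : Space N → ℝ} (hf : f ∈ TestFun N) :
    MorreyBound s p (morreyConstant N s p ^ (1 / p)) f := by
  intro x y
  by_cases hxy : f x = f y
  · simp [hxy]
  have hα := holderExponent_pos hp hsp
  obtain ⟨g, hg, hg1, hgf⟩ := exists_normalized_testFun (s := s) hp hα
    (holderExponent_lt_one hN hs1 hp) hf hxy
  have h1 : morreyConstant N s p ^ (1 / p) ≤ sobolevSeminorm s p g := by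
    have hp0 : 0 < p := by linarith
    rw [one_div, ENNReal.rpow_inv_le_iff hp0]
    exact iInf₂_le_of_le g hg (iInf_le _ hg1)
  rw [← hgf, mul_assoc]
  exact mul_le_mul' h1 (enorm_sub_le_holderSeminorm_mul hα f x y)

/-- Cutting off a bounded function at scale `R` costs `R ^ (-α)` in the seminorm. -/
theorem morreyBound_of_bounded (hN : 1 ≤ N) {s p : ℝ} (hs0 : 0 < s) (hs1 : s ≤ 1) (hp : 1 < p)
    (hsp : (N : ℝ) < s * p) {f : Space N → ℝ} (hf : ContDiff ℝ ∞ f) {M : ℝ}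
    (hM : ∀ x, |f x| ≤ M) : MorreyBound s p (morreyConstant N s p ^ (1 / p)) f := by
  have hα := holderExponent_pos hp hsp
  have hc : morreyConstant N s p ^ (1 / p) ≠ ⊤ := ENNReal.rpow_ne_top_of_nonneg
    (one_div_nonneg.2 (by linarith)) (morreyConstant_lt_top hN hs0 hs1 hp hsp).ne
  let η : ContDiffBump (0 : Space N) := ⟨1, 2, one_pos, one_lt_two⟩
  have hη : (η : Space N → ℝ) ∈ TestFun N := ⟨η.contDiff, η.hasCompactSupport⟩
  set r : ℕ → ℝ := fun n => 1 / ((n : ℝ) + 1) with hr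
  have hr0 : ∀ n, 0 < r n := fun n => by positivity
  have hrt : Tendsto r atTop (𝓝 0) := tendsto_one_div_add_atTop_nhds_zero_nat
  have hηn : ∀ n, (fun x => η (0 + r n • x)) ∈ TestFun N := fun n => by
    refine ⟨η.contDiff.comp (contDiff_const.add (contDiff_const_smul (r n))), ?_⟩
    simp only [zero_add]
    exact η.hasCompactSupport.comp_homeomorph (Homeomorph.smulOfNeZero (r n) (hr0 n).ne')
  refine MorreyBound.of_tendsto hα hc (f := fun n x => f x * η (0 + r n • x))
    (S := fun n => sobolevSeminorm s p f +
      ‖M‖ₑ * (ENNReal.ofReal (r n ^ holderExponent N s p) * sobolevSeminorm s p η))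
    (fun n => ?_) (fun x => ?_) (fun n => ?_) ?_
  · exact morreyBound_of_mem_testFun hN hs1 hp hsp ⟨hf.mul (hηn n).1, (hηn n).2.mul_left⟩
  · have h1 : Tendsto (fun n => r n • x) atTop (𝓝 0) := by simpa using hrt.smul_const x
    refine tendsto_const_nhds.congr' ?_
    filter_upwards [h1.eventually (Metric.closedBall_mem_nhds 0 one_pos)] with n hn
    rw [zero_add, η.one_of_mem_closedBall hn, mul_one]
  · rw [← sobolevSeminorm_comp_affine hp (TestFun.contDiff_one hη) 0 (hr0 n)]
    exact sobolevSeminorm_mul_le hp (hf.of_le (by simp)) (TestFun.contDiff_one (hηn n)) hM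
      fun x => by rw [abs_of_nonneg η.nonneg]; exact η.le_one
  · have h2 : Tendsto (fun n => r n ^ holderExponent N s p) atTop (𝓝 0) := by
      have := hrt.rpow_const (p := holderExponent N s p) (.inr hα.le)
      rwa [Real.zero_rpow hα.ne'] at this
    have h3 : Tendsto (fun n => ENNReal.ofReal (r n ^ holderExponent N s p)) atTop (𝓝 0) := by
      simpa using ENNReal.tendsto_ofReal h2
    have h4 := ENNReal.Tendsto.mul_const (b := sobolevSeminorm s p η) h3
      (.inr (sobolevSeminorm_lt_top_of_mem_testFun hN hs0 hs1 hp hη).ne)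
    have h5 := ENNReal.Tendsto.const_mul (a := ‖M‖ₑ) h4 (.inr enorm_ne_top)
    simpa using h5.const_add (sobolevSeminorm s p f)

theorem tendsto_mul_sin_div_nat (t : ℝ) :
    Tendsto (fun n : ℕ => ((n : ℝ) + 1) * Real.sin (t / ((n : ℝ) + 1))) atTop (𝓝 t) := by
  have h1 : Tendsto (fun n : ℕ => t * (1 / ((n : ℝ) + 1))) atTop (𝓝 0) := by
    simpa using (tendsto_one_div_add_atTop_nhds_zero_nat (𝕜 := ℝ)).const_mul t
  have h2 := ((Real.continuous_sinc.tendsto 0).comp h1).const_mul t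
  rw [Real.sinc_zero, mul_one] at h2
  refine h2.congr fun n => ?_
  by_cases ht : t = 0
  · simp [ht]
  have hn : (n : ℝ) + 1 ≠ 0 := by positivity
  rw [Function.comp_apply, Real.sinc_of_ne_zero (by positivity), mul_one_div]
  field_simp

/-- The bounded functions `M sin (f / M)` have smaller seminorm than `f` and converge to `f`. -/
theorem morreyBound_of_contDiff (hN : 1 ≤ N) {s p : ℝ} (hs0 : 0 < s) (hs1 : s ≤ 1) (hp : 1 < p)
    (hsp : (N : ℝ) < s * p) {f : Space N → ℝ} (hf : ContDiff ℝ ∞ f) :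
    MorreyBound s p (morreyConstant N s p ^ (1 / p)) f := by
  have hc : morreyConstant N s p ^ (1 / p) ≠ ⊤ := ENNReal.rpow_ne_top_of_nonneg
    (one_div_nonneg.2 (by linarith)) (morreyConstant_lt_top hN hs0 hs1 hp hsp).ne
  refine MorreyBound.of_tendsto (holderExponent_pos hp hsp) hc
    (f := fun n x => ((n : ℝ) + 1) * Real.sin (f x / ((n : ℝ) + 1)))
    (fun n => ?_) (fun x => tendsto_mul_sin_div_nat _)
    (fun n => sobolevSeminorm_mul_sin_le hp (hf.of_le (by simp)) (by positivity))
    tendsto_const_nhds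
  refine morreyBound_of_bounded hN hs0 hs1 hp hsp (M := (n : ℝ) + 1)
    (contDiff_const.mul (Real.contDiff_sin.comp (hf.div_const _))) fun x => ?_
  rw [abs_mul, abs_of_nonneg (by positivity : (0 : ℝ) ≤ (n : ℝ) + 1)]
  exact mul_le_of_le_one_right (by positivity) (Real.abs_sin_le_one _)

theorem morreyBound_of_continuous (hN : 1 ≤ N) {s p : ℝ} (hs0 : 0 < s) (hs1 : s ≤ 1) (hp : 1 < p)
    (hsp : (N : ℝ) < s * p) {f : Space N → ℝ} (hf : Continuous f) :
    MorreyBound s p (morreyConstant N s p ^ (1 / p)) f := by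
  have hc : morreyConstant N s p ^ (1 / p) ≠ ⊤ := ENNReal.rpow_ne_top_of_nonneg
    (one_div_nonneg.2 (by linarith)) (morreyConstant_lt_top hN hs0 hs1 hp hsp).ne
  let ρ : ℕ → ContDiffBump (0 : Space N) := fun n =>
    ⟨1 / ((n : ℝ) + 1), 2 * (1 / ((n : ℝ) + 1)), by positivity, by
      have : (0 : ℝ) < 1 / ((n : ℝ) + 1) := by positivity
      linarith⟩
  have hρ : Tendsto (fun n => (ρ n).rOut) atTop (𝓝 0) := by
    have h := (tendsto_one_div_add_atTop_nhds_zero_nat (𝕜 := ℝ)).const_mul 2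
    rwa [mul_zero] at h
  exact MorreyBound.of_tendsto (holderExponent_pos hp hsp) hc (f := fun n => mollify (ρ n) f)
    (fun n => morreyBound_of_contDiff hN hs0 hs1 hp hsp
      (contDiff_mollify (ρ n) hf.locallyIntegrable))
    (fun x => ContDiffBump.convolution_tendsto_right_of_continuous hρ hf x)
    (fun n => sobolevSeminorm_mollify_le (ρ n) hp hf) tendsto_const_nhds

theorem morreyConstant_mul_holderSeminorm_rpow_le (hN : 1 ≤ N) {s p : ℝ} (hs0 : 0 < s)
    (hs1 : s ≤ 1) (hp : 1 < p) (hsp : (N : ℝ) < s * p) {f : Space N → ℝ} (hf : Continuous f) :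
    morreyConstant N s p * holderSeminorm (holderExponent N s p) f ^ p ≤
      sobolevSeminorm s p f ^ p := by
  have hp0 : 0 < p := by linarith
  have h := ENNReal.rpow_le_rpow (mul_holderSeminorm_le
    (morreyBound_of_continuous hN hs0 hs1 hp hsp hf)) hp0.le
  rwa [ENNReal.mul_rpow_of_nonneg _ _ hp0.le, ← ENNReal.rpow_mul, one_div_mul_cancel hp0.ne',
    ENNReal.rpow_one] at h

theorem morreyConstant_eq_relaxedMorreyConstant (hN : 1 ≤ N) {s p : ℝ} (hs0 : 0 < s)
    (hs1 : s ≤ 1) (hp : 1 < p) (hsp : (N : ℝ) < s * p) :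
    morreyConstant N s p = relaxedMorreyConstant N s p := by
  refine le_antisymm (le_iInf₂ fun f hf => le_iInf fun h1 => ?_)
    (le_iInf₂ fun f hf => le_iInf fun h1 => ?_)
  · simpa [h1] using morreyConstant_mul_holderSeminorm_rpow_le hN hs0 hs1 hp hsp hf.1.1
  · exact iInf₂_le_of_le f ⟨⟨hf.1.continuous, by simp [h1]⟩,
      sobolevSeminorm_lt_top_of_mem_testFun hN hs0 hs1 hp hf⟩ (iInf_le _ h1)

/-! ### Uniform convexity of the `p`-th power of the norm -/

section convexity

variable {E : Type*} [NormedAddCommGroup E] [InnerProductSpace ℝ E]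

theorem norm_midpoint_rpow_lt {p : ℝ} (hp : 1 < p) {a b : E} (hab : a ≠ b) :
    ‖(1 / 2 : ℝ) • (a + b)‖ ^ p < (‖a‖ ^ p + ‖b‖ ^ p) / 2 := by
  have hp0 : 0 < p := by linarith
  have hn : ‖(1 / 2 : ℝ) • (a + b)‖ = ‖a + b‖ / 2 := by
    rw [norm_smul]; norm_num; ring
  rw [hn]
  by_cases h : ‖a‖ = ‖b‖
  · have h1 : ‖a + b‖ < ‖a‖ + ‖b‖ := norm_add_lt_of_not_sameRay fun hr => hab
      ((sameRay_iff_of_norm_eq h).1 hr)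
    calc (‖a + b‖ / 2) ^ p < ‖a‖ ^ p :=
          Real.rpow_lt_rpow (by positivity) (by linarith) hp0
      _ = (‖a‖ ^ p + ‖b‖ ^ p) / 2 := by rw [← h]; ring
  · have h1 := (strictConvexOn_rpow hp).2 (norm_nonneg a) (norm_nonneg b) h
      (by norm_num : (0 : ℝ) < 1 / 2) (by norm_num : (0 : ℝ) < 1 / 2) (by norm_num)
    simp only [smul_eq_mul] at h1
    calc (‖a + b‖ / 2) ^ p ≤ (1 / 2 * ‖a‖ + 1 / 2 * ‖b‖) ^ p := by
          refine Real.rpow_le_rpow (by positivity) ?_ hp0.le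
          have := norm_add_le a b
          linarith
      _ < 1 / 2 * ‖a‖ ^ p + 1 / 2 * ‖b‖ ^ p := h1
      _ = (‖a‖ ^ p + ‖b‖ ^ p) / 2 := by ring

/-- A quantitative form of strict convexity: the distance of `a` and `b` is controlled by the
convexity defect of `‖·‖ ^ p` at their midpoint, up to an arbitrarily small fraction of the sizes.
By homogeneity this is a statement on a compact set. -/
theorem exists_norm_sub_rpow_le [FiniteDimensional ℝ E] {p : ℝ} (hp : 1 < p) {ε : ℝ}
    (hε : 0 < ε) : ∃ C : ℝ, 0 ≤ C ∧ ∀ a b : E, ‖a - b‖ ^ p + C * ‖(1 / 2 : ℝ) • (a + b)‖ ^ p ≤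
      (ε + C / 2) * (‖a‖ ^ p + ‖b‖ ^ p) := by
  have hp0 : 0 < p := by linarith
  set Φ : E × E → ℝ := fun z => (‖z.1‖ ^ p + ‖z.2‖ ^ p) / 2 - ‖(1 / 2 : ℝ) • (z.1 + z.2)‖ ^ p
    with hΦ
  have hpow : ∀ {f : E × E → E}, Continuous f → Continuous fun z => ‖f z‖ ^ p := fun hf =>
    hf.norm.rpow_const fun _ => .inr hp0.le
  have hΦc : Continuous Φ := by
    refine (((hpow continuous_fst).add (hpow continuous_snd)).div_const 2).sub (hpow ?_)
    fun_prop
  have hΦ0 : ∀ a b, 0 ≤ Φ (a, b) := fun a b => by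
    by_cases hab : a = b
    · have h2 : (1 / 2 : ℝ) • (b + b) = b := by rw [← two_smul ℝ b, smul_smul]; norm_num
      simp only [hΦ, hab, h2]
      linarith
    · exact (sub_pos.2 (norm_midpoint_rpow_lt hp hab)).le
  set K : Set (E × E) := {z | ‖z.1‖ ^ p + ‖z.2‖ ^ p = 1 ∧ ε ≤ ‖z.1 - z.2‖ ^ p} with hK
  have hKc : IsCompact K := by
    refine Metric.isCompact_of_isClosed_isBounded ?_ ?_
    · exact (isClosed_eq ((hpow continuous_fst).add (hpow continuous_snd))
        continuous_const).inter (isClosed_le continuous_const (hpow (by fun_prop)))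
    · refine (Metric.isBounded_closedBall (x := (0 : E × E)) (r := 1)).subset fun z hz => ?_
      have hle : ∀ c : E, ‖c‖ ^ p ≤ 1 → ‖c‖ ≤ 1 := fun c hc =>
        (Real.rpow_le_rpow_iff (norm_nonneg c) zero_le_one hp0).1 (by simpa using hc)
      have h1 : 0 ≤ ‖z.1‖ ^ p := by positivity
      have h2 : 0 ≤ ‖z.2‖ ^ p := by positivity
      rw [mem_closedBall_zero_iff, Prod.norm_def, max_le_iff]
      exact ⟨hle _ (by linarith [hz.1]), hle _ (by linarith [hz.1])⟩
  have hpos : ∀ z ∈ K, 0 < Φ z := fun z hz => by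
    refine sub_pos.2 (norm_midpoint_rpow_lt hp fun h => ?_)
    have := hz.2
    rw [h, sub_self, norm_zero, Real.zero_rpow hp0.ne'] at this
    linarith
  obtain ⟨C, hC⟩ := hKc.exists_bound_of_continuousOn (f := fun z => ‖z.1 - z.2‖ ^ p / Φ z)
    ((hpow (by fun_prop)).continuousOn.div hΦc.continuousOn fun z hz => (hpos z hz).ne')
  have hunit : ∀ a b : E, ‖a‖ ^ p + ‖b‖ ^ p = 1 → ‖a - b‖ ^ p ≤ ε + max C 0 * Φ (a, b) := by
    intro a b hab
    have hC0 : 0 ≤ max C 0 * Φ (a, b) := mul_nonneg (le_max_right _ _) (hΦ0 a b)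
    rcases le_total (‖a - b‖ ^ p) ε with h | h
    · linarith
    · have h1 := (le_abs_self _).trans (hC (a, b) ⟨hab, h⟩)
      rw [div_le_iff₀ (hpos (a, b) ⟨hab, h⟩)] at h1
      have h2 := mul_le_mul_of_nonneg_right (le_max_left C 0) (hΦ0 a b)
      simp only at h1
      linarith
  refine ⟨max C 0, le_max_right _ _, fun a b => ?_⟩
  set T := ‖a‖ ^ p + ‖b‖ ^ p with hT
  have hT0 : 0 ≤ T := by positivity
  rcases hT0.eq_or_lt with h0 | h0
  · have ha : ‖a‖ ^ p = 0 := by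
      have h1 : 0 ≤ ‖a‖ ^ p := by positivity
      have h2 : 0 ≤ ‖b‖ ^ p := by positivity
      linarith
    have hb : ‖b‖ ^ p = 0 := by linarith
    rw [Real.rpow_eq_zero (norm_nonneg _) hp0.ne', norm_eq_zero] at ha hb
    rw [← h0, ha, hb]
    simp [Real.zero_rpow hp0.ne']
  · set r := T ^ (-(1 / p)) with hr
    have hr0 : 0 < r := Real.rpow_pos_of_pos h0 _
    have hrp : r ^ p = T⁻¹ := by
      rw [hr, ← Real.rpow_mul h0.le, neg_mul, one_div_mul_cancel hp0.ne', Real.rpow_neg_one]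
    have hs : ∀ c : E, ‖r • c‖ ^ p = T⁻¹ * ‖c‖ ^ p := fun c => by
      rw [norm_smul, Real.norm_of_nonneg hr0.le, Real.mul_rpow hr0.le (norm_nonneg _), hrp]
    have h1 := hunit (r • a) (r • b) (by
      rw [hs, hs, ← mul_add, ← hT, inv_mul_cancel₀ h0.ne'])
    simp only [hΦ] at h1
    rw [← smul_add, smul_comm, ← smul_sub, hs, hs, hs, hs, ← mul_add, ← hT] at h1
    have h2 := mul_le_mul_of_nonneg_left h1 h0.le
    rw [← mul_assoc, mul_inv_cancel₀ h0.ne', one_mul] at h2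
    have h3 : T * (ε + max C 0 * (T⁻¹ * T / 2 - T⁻¹ * ‖(1 / 2 : ℝ) • (a + b)‖ ^ p)) =
        (ε + max C 0 / 2) * T - max C 0 * ‖(1 / 2 : ℝ) • (a + b)‖ ^ p := by
      field_simp
      ring
    linarith

theorem exists_enorm_sub_rpow_le [FiniteDimensional ℝ E] {p : ℝ} (hp : 1 < p) {ε : NNReal}
    (hε : 0 < ε) : ∃ C : NNReal, ∀ a b : E,
      ‖a - b‖ₑ ^ p + C * 2 * ‖(1 / 2 : ℝ) • (a + b)‖ₑ ^ p ≤ (ε + C) * (‖a‖ₑ ^ p + ‖b‖ₑ ^ p) := by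
  have hp0 : 0 < p := by linarith
  obtain ⟨C, hC0, hC⟩ := exists_norm_sub_rpow_le (E := E) hp (NNReal.coe_pos.2 hε)
  lift C to NNReal using hC0
  refine ⟨C / 2, fun a b => ?_⟩
  have he : ∀ c : E, ‖c‖ₑ ^ p = ((‖c‖₊ ^ p : NNReal) : ℝ≥0∞) := fun c => by
    rw [ENNReal.coe_rpow_of_nonneg _ hp0.le]; rfl
  have h : ‖a - b‖₊ ^ p + C / 2 * 2 * ‖(1 / 2 : ℝ) • (a + b)‖₊ ^ p ≤
      (ε + C / 2) * (‖a‖₊ ^ p + ‖b‖₊ ^ p) := by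
    rw [div_mul_cancel₀ C two_ne_zero]
    exact_mod_cast hC a b
  simp_rw [he]
  exact_mod_cast h

/-- A minimising sequence for the `L ^ p` norm whose midpoints are almost no better than its
members converges in `L ^ p`. -/
theorem exists_tendsto_eLpNorm_sub_of_midpoint [FiniteDimensional ℝ E] {X : Type*}
    [MeasurableSpace X] {μ : Measure X} {p : ℝ} (hp : 1 < p) {A : ℕ → X → E}
    (hA : ∀ n, AEStronglyMeasurable (A n) μ) {m : ℝ≥0∞} (hm : m ≠ ⊤) {B : ℕ → ℝ≥0∞}
    (hBt : ∀ n, B n ≠ ⊤) (hAB : ∀ n, ∫⁻ x, ‖A n x‖ₑ ^ p ∂μ ≤ B n) (hB : Tendsto B atTop (𝓝 m))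
    {L : ℕ × ℕ → ℝ≥0∞} (hL : Tendsto L atTop (𝓝 m))
    (hLA : ∀ q, L q ≤ ∫⁻ x, ‖(1 / 2 : ℝ) • (A q.1 x + A q.2 x)‖ₑ ^ p ∂μ) :
    ∃ G, MemLp G (ENNReal.ofReal p) μ ∧ ∫⁻ x, ‖G x‖ₑ ^ p ∂μ ≤ m ∧
      Tendsto (fun n => eLpNorm (A n - G) (ENNReal.ofReal p) μ) atTop (𝓝 0) := by
  have hp0 : 0 < p := by linarith
  have hpE : Fact (1 ≤ ENNReal.ofReal p) := ⟨by simpa using ENNReal.ofReal_le_ofReal hp.le⟩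
  have hnorm : ∀ f : X → E, eLpNorm f (ENNReal.ofReal p) μ = (∫⁻ x, ‖f x‖ₑ ^ p ∂μ) ^ (1 / p) :=
    fun f => by
      rw [eLpNorm_eq_lintegral_rpow_enorm_toReal (by simpa using hp0) (by simp),
        ENNReal.toReal_ofReal hp0.le]
  have hAL : ∀ n, MemLp (A n) (ENNReal.ofReal p) μ := fun n => by
    refine ⟨hA n, ?_⟩
    rw [hnorm]
    exact ENNReal.rpow_lt_top_of_nonneg (by positivity) ((hAB n).trans_lt (hBt n).lt_top).ne
  have hfst : Tendsto Prod.fst (atTop : Filter (ℕ × ℕ)) atTop := by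
    rw [← prod_atTop_atTop_eq]; exact tendsto_fst
  have hsnd : Tendsto Prod.snd (atTop : Filter (ℕ × ℕ)) atTop := by
    rw [← prod_atTop_atTop_eq]; exact tendsto_snd
  have hD : Tendsto (fun q : ℕ × ℕ => ∫⁻ x, ‖A q.1 x - A q.2 x‖ₑ ^ p ∂μ) atTop (𝓝 0) := by
    rw [ENNReal.tendsto_nhds_zero]
    intro e he
    obtain ⟨ε, hε, hεe⟩ : ∃ ε : NNReal, 0 < ε ∧ ε * (m + m) < e := by
      have h : Tendsto (fun ε : NNReal => (ε : ℝ≥0∞) * (m + m)) (𝓝[>] 0) (𝓝 (0 * (m + m))) :=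
        ENNReal.Tendsto.mul_const (by
          rw [← ENNReal.coe_zero]
          exact (ENNReal.tendsto_coe.2 tendsto_id).mono_left nhdsWithin_le_nhds)
          (.inr (by simp [hm]))
      rw [zero_mul] at h
      obtain ⟨ε, h1, h2⟩ := ((h.eventually_lt_const he).and self_mem_nhdsWithin).exists
      exact ⟨ε, h2, h1⟩
    obtain ⟨C, hC⟩ := exists_enorm_sub_rpow_le (E := E) hp hε
    have hmain : ∀ q : ℕ × ℕ, ∫⁻ x, ‖A q.1 x - A q.2 x‖ₑ ^ p ∂μ + C * 2 * L q ≤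
        (ε + C) * (B q.1 + B q.2) := by
      intro q
      have h1 := (hA q.1).enorm.pow_const p
      have h2 := (hA q.2).enorm.pow_const p
      have h3 : AEMeasurable (fun x => ‖A q.1 x - A q.2 x‖ₑ ^ p) μ :=
        ((hA q.1).sub (hA q.2)).enorm.pow_const p
      calc _ ≤ ∫⁻ x, ‖A q.1 x - A q.2 x‖ₑ ^ p ∂μ +
            C * 2 * ∫⁻ x, ‖(1 / 2 : ℝ) • (A q.1 x + A q.2 x)‖ₑ ^ p ∂μ := by
            gcongr
            exact hLA q
        _ = ∫⁻ x, (‖A q.1 x - A q.2 x‖ₑ ^ p +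
              C * 2 * ‖(1 / 2 : ℝ) • (A q.1 x + A q.2 x)‖ₑ ^ p) ∂μ := by
            rw [lintegral_add_left' h3, lintegral_const_mul' _ _ (by finiteness)]
        _ ≤ ∫⁻ x, (ε + C) * (‖A q.1 x‖ₑ ^ p + ‖A q.2 x‖ₑ ^ p) ∂μ :=
            lintegral_mono fun x => hC _ _
        _ = (ε + C) * (∫⁻ x, ‖A q.1 x‖ₑ ^ p ∂μ + ∫⁻ x, ‖A q.2 x‖ₑ ^ p ∂μ) := by
            rw [lintegral_const_mul' _ _ (by finiteness), lintegral_add_left' h1]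
        _ ≤ _ := by
            gcongr <;> exact hAB _
    have hlim : Tendsto (fun q : ℕ × ℕ => (ε + C) * (B q.1 + B q.2) - C * 2 * L q) atTop
        (𝓝 ((ε + C) * (m + m) - C * 2 * m)) :=
      ENNReal.Tendsto.sub (ENNReal.Tendsto.const_mul ((hB.comp hfst).add (hB.comp hsnd))
        (.inr (by finiteness))) (ENNReal.Tendsto.const_mul hL (.inr (by finiteness)))
        (.inr (by finiteness))
    have hval : (ε + C) * (m + m) - C * 2 * m = (ε : ℝ≥0∞) * (m + m) := by
      rw [add_mul, show (C : ℝ≥0∞) * (m + m) = C * 2 * m by ring]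
      exact ENNReal.add_sub_cancel_right (by finiteness)
    rw [hval] at hlim
    filter_upwards [hlim.eventually_lt_const hεe, hL.eventually_lt_const hm.lt_top] with q hq hqt
    exact (ENNReal.le_sub_of_add_le_right (by finiteness) (hmain q)).trans hq.le
  have hcau : CauchySeq fun n => (hAL n).toLp (A n) := by
    rw [cauchySeq_iff_tendsto_dist_atTop_0]
    have h1 := (ENNReal.continuous_rpow_const (y := 1 / p)).tendsto 0 |>.comp hD
    rw [ENNReal.zero_rpow_of_pos (by positivity)] at h1
    have h2 := (ENNReal.tendsto_toReal ENNReal.zero_ne_top).comp h1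
    refine h2.congr fun q => ?_
    rw [dist_edist, Lp.edist_toLp_toLp, hnorm]
    rfl
  obtain ⟨G, hG⟩ := cauchySeq_tendsto_of_complete hcau
  have hGt : Tendsto (fun n => eLpNorm (A n - ⇑G) (ENNReal.ofReal p) μ) atTop (𝓝 0) := by
    rw [Lp.tendsto_Lp_iff_tendsto_eLpNorm'] at hG
    refine hG.congr fun n => eLpNorm_congr_ae ?_
    filter_upwards [(hAL n).coeFn_toLp] with x hx
    simp [hx]
  refine ⟨G, Lp.memLp G, ?_, hGt⟩
  have h1 : ∀ n, eLpNorm G (ENNReal.ofReal p) μ ≤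
      B n ^ (1 / p) + eLpNorm (A n - ⇑G) (ENNReal.ofReal p) μ := by
    intro n
    have h2 : eLpNorm (A n) (ENNReal.ofReal p) μ ≤ B n ^ (1 / p) := by
      rw [hnorm]
      gcongr
      exact hAB n
    have h3 := eLpNorm_sub_le (hA n) ((hA n).sub (Lp.memLp G).1) hpE.out
    rw [sub_sub_cancel] at h3
    exact h3.trans (by gcongr)
  have h4 := ge_of_tendsto' (((ENNReal.continuous_rpow_const.tendsto m).comp hB).add hGt) h1
  rwa [add_zero, hnorm, ENNReal.rpow_le_rpow_iff (by positivity)] at h4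

end convexity

/-! ### Lower semicontinuity of the seminorms -/

theorem gagliardoSeminorm_rpow_le_of_tendsto {s p : ℝ} (hp : 1 < p) {f : ℕ → Space N → ℝ}
    (hf : ∀ n, Continuous (f n)) {u : Space N → ℝ}
    (hfu : ∀ x, Tendsto (fun n => f n x) atTop (𝓝 (u x))) {B : ℕ → ℝ≥0∞} {m : ℝ≥0∞}
    (hB : ∀ n, gagliardoSeminorm s p (f n) ^ p ≤ B n) (hBm : Tendsto B atTop (𝓝 m)) :
    gagliardoSeminorm s p u ^ p ≤ m := by
  have hp0 : 0 < p := by linarith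
  have hpow : ∀ k : Space N → ℝ, gagliardoSeminorm s p k ^ p = ∫⁻ z : Space N × Space N,
      ‖k z.1 - k z.2‖ₑ ^ p / ‖z.1 - z.2‖ₑ ^ ((N : ℝ) + s * p) := fun k => by
    rw [gagliardoSeminorm, ← ENNReal.rpow_mul, one_div_mul_cancel hp0.ne', ENNReal.rpow_one]
  simp_rw [hpow] at hB ⊢
  have hm : ∀ n, Measurable fun z : Space N × Space N =>
      ‖f n z.1 - f n z.2‖ₑ ^ p / ‖z.1 - z.2‖ₑ ^ ((N : ℝ) + s * p) := fun n => by
    have := (hf n).measurable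
    fun_prop
  calc _ = ∫⁻ z : Space N × Space N, liminf (fun n =>
        ‖f n z.1 - f n z.2‖ₑ ^ p / ‖z.1 - z.2‖ₑ ^ ((N : ℝ) + s * p)) atTop := by
        refine lintegral_congr fun z => (Tendsto.liminf_eq ?_).symm
        by_cases hz : z.1 = z.2
        -- On the diagonal all quotients are `0 / 0 = 0`.
        · simp [hz, ENNReal.zero_rpow_of_pos hp0]
        · have h0 : ‖z.1 - z.2‖ₑ ≠ 0 := by simpa [sub_eq_zero] using hz
          refine ENNReal.Tendsto.div_const ?_ (.inr ?_)
          · exact (ENNReal.continuous_rpow_const.tendsto _).comp ((hfu z.1).sub (hfu z.2)).enorm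
          · simp [ENNReal.rpow_eq_zero_iff, h0]
    _ ≤ liminf (fun n => ∫⁻ z : Space N × Space N,
        ‖f n z.1 - f n z.2‖ₑ ^ p / ‖z.1 - z.2‖ₑ ^ ((N : ℝ) + s * p)) atTop :=
        lintegral_liminf_le hm
    _ ≤ liminf B atTop := liminf_le_liminf (.of_forall hB)
    _ = m := hBm.liminf_eq

/-- Weak gradients pass to the limit when the functions converge pointwise under a continuous
bound and the gradients converge in `L ^ p`. -/
theorem IsWeakGradient.of_tendsto {p : ℝ} (hp : 1 < p) {f : ℕ → Space N → ℝ}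
    {A : ℕ → Space N → Space N} (hfA : ∀ n, IsWeakGradient (f n) (A n)) {u b : Space N → ℝ}
    (hu : Continuous u) (hb : Continuous b) (hfb : ∀ n x, |f n x| ≤ b x)
    (hfu : ∀ x, Tendsto (fun n => f n x) atTop (𝓝 (u x))) {G : Space N → Space N}
    (hG : MemLp G (ENNReal.ofReal p))
    (hAG : Tendsto (fun n => eLpNorm (A n - G) (ENNReal.ofReal p)) atTop (𝓝 0)) :
    IsWeakGradient u G := by
  have hp0 : 0 < p := by linarith
  have hGl : LocallyIntegrable G :=
    hG.locallyIntegrable (by simpa using ENNReal.ofReal_le_ofReal hp.le)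
  refine ⟨hu.locallyIntegrable, hGl, fun ψ hψ v => ?_⟩
  obtain ⟨hψs, hψc⟩ := hψ
  have hdc : Continuous fun x => fderiv ℝ ψ x v :=
    (hψs.continuous_fderiv (by simp)).clm_apply continuous_const
  have hdcc : HasCompactSupport fun x => fderiv ℝ ψ x v :=
    (hψc.fderiv ℝ).comp_left (g := fun L : Space N →L[ℝ] ℝ => L v) rfl
  have hL : Tendsto (fun n => ∫ x, f n x * fderiv ℝ ψ x v) atTop
      (𝓝 (∫ x, u x * fderiv ℝ ψ x v)) := by
    refine tendsto_integral_of_dominated_convergence (fun x => b x * |fderiv ℝ ψ x v|)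
      (fun n => (hfA n).locallyIntegrable.aestronglyMeasurable.mul hdc.aestronglyMeasurable)
      ((hb.mul hdc.abs).integrable_of_hasCompactSupport hdcc.norm.mul_left)
      (fun n => .of_forall fun x => ?_) (.of_forall fun x => (hfu x).mul_const _)
    rw [Real.norm_eq_abs, abs_mul]
    exact mul_le_mul_of_nonneg_right (hfb n x) (abs_nonneg _)
  have hi : ∀ {K : Space N → Space N}, LocallyIntegrable K →
      Integrable fun x => ψ x * inner ℝ (K x) v := fun hK => by
    refine ((hK.integrable_smul_left_of_hasCompactSupport hψs.continuous hψc).inner_const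
      (𝕜 := ℝ) v).congr (.of_forall fun x => ?_)
    simp only [real_inner_smul_left]
  have hR : Tendsto (fun n => ∫ x, ψ x * inner ℝ (A n x) v) atTop
      (𝓝 (∫ x, ψ x * inner ℝ (G x) v)) := by
    refine tendsto_integral_of_L1 _ (hi hGl).1
      (.of_forall fun n => hi (hfA n).locallyIntegrable_grad) ?_
    have hpq := Real.HolderConjugate.conjExponent hp
    set q := p.conjExponent
    have hq0 : 0 < q := hpq.symm.pos
    set D := (∫⁻ x, ‖ψ x‖ₑ ^ q) ^ (1 / q)
    have hD : D ≠ ⊤ := by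
      have h := (hψs.continuous.memLp_of_hasCompactSupport (p := ENNReal.ofReal q)
        (μ := volume) hψc).eLpNorm_lt_top
      rw [eLpNorm_eq_lintegral_rpow_enorm_toReal (by simpa using hq0) (by simp),
        ENNReal.toReal_ofReal hq0.le] at h
      exact h.ne
    have hle : ∀ n, ∫⁻ x, ‖ψ x * inner ℝ (A n x) v - ψ x * inner ℝ (G x) v‖ₑ ≤
        eLpNorm (A n - G) (ENNReal.ofReal p) * D * ‖v‖ₑ := by
      intro n
      have hm := (hfA n).locallyIntegrable_grad.aestronglyMeasurable.sub hG.1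
      have h1 := ENNReal.lintegral_mul_le_Lp_mul_Lq volume hpq hm.enorm
        hψs.continuous.enorm.aemeasurable
      rw [eLpNorm_eq_lintegral_rpow_enorm_toReal (by simpa using hp0) (by simp),
        ENNReal.toReal_ofReal hp0.le]
      refine le_trans ?_ (mul_le_mul_left h1 ‖v‖ₑ)
      rw [← lintegral_mul_const' _ _ enorm_ne_top]
      refine lintegral_mono fun x => ?_
      rw [← mul_sub, ← inner_sub_left, enorm_mul, Pi.mul_apply, mul_comm ‖(A n - G) x‖ₑ, mul_assoc]
      gcongr
      simp only [← ofReal_norm]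
      rw [← ENNReal.ofReal_mul (norm_nonneg _)]
      exact ENNReal.ofReal_le_ofReal (norm_inner_le_norm _ _)
    have h2 := ENNReal.Tendsto.mul_const (b := ‖v‖ₑ)
      (ENNReal.Tendsto.mul_const (b := D) hAG (.inr hD)) (.inr enorm_ne_top)
    rw [zero_mul, zero_mul] at h2
    exact tendsto_of_tendsto_of_tendsto_of_le_of_le tendsto_const_nhds h2 (fun _ => zero_le) hle
  refine tendsto_nhds_unique hL (hR.neg.congr fun n => ?_)
  exact ((hfA n).integral_eq ψ ⟨hψs, hψc⟩ v).symm

/-! ### Compactness of normalised almost extremal functions -/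

/-- Almost extremal functions, moved by a translation and a dilation so that their Hölder quotient
is almost attained at the origin and at a unit vector. -/
theorem exists_almost_extremal (hN : 1 ≤ N) {s p : ℝ} (hs0 : 0 < s) (hs1 : s ≤ 1) (hp : 1 < p)
    (hsp : (N : ℝ) < s * p) {δ : ℝ} (hδ : 0 < δ) :
    ∃ (g : Space N → ℝ) (e : Space N), ContDiff ℝ ∞ g ∧ g 0 = 0 ∧
      (∀ x y, |g x - g y| ≤ ‖x - y‖ ^ holderExponent N s p) ∧ ‖e‖ = 1 ∧ 1 - δ ≤ g e ∧
      sobolevSeminorm s p g ^ p ≤ morreyConstant N s p + ENNReal.ofReal δ := by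
  have hα := holderExponent_pos hp hsp
  set α := holderExponent N s p
  have hlt : morreyConstant N s p < morreyConstant N s p + ENNReal.ofReal δ :=
    ENNReal.lt_add_right (morreyConstant_lt_top hN hs0 hs1 hp hsp).ne (by simpa using hδ)
  nth_rewrite 1 [morreyConstant] at hlt
  simp only [iInf_lt_iff] at hlt
  obtain ⟨f, hf, hf1, hfm⟩ := hlt
  have hfα : ∀ x y, |f x - f y| ≤ ‖x - y‖ ^ α := by
    intro x y
    have h := enorm_sub_le_holderSeminorm_mul hα f x y
    rw [hf1, one_mul, ← ofReal_norm, ← ofReal_norm,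
      ENNReal.ofReal_rpow_of_nonneg (norm_nonneg _) hα.le,
      ENNReal.ofReal_le_ofReal_iff (by positivity)] at h
    exact h
  obtain ⟨x, y, hxy, hq⟩ : ∃ x y, x ≠ y ∧ (1 - δ) * ‖x - y‖ ^ α ≤ |f x - f y| := by
    have h : ENNReal.ofReal (1 - δ) < holderSeminorm α f := by
      rw [hf1, ENNReal.ofReal_lt_one]
      linarith
    simp only [holderSeminorm, lt_iSup_iff] at h
    obtain ⟨x, y, hxy, h⟩ := h
    have hr : 0 < ‖x - y‖ := norm_pos_iff.2 (sub_ne_zero.2 hxy)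
    rw [← ofReal_norm, ← ofReal_norm, ENNReal.ofReal_rpow_of_pos hr,
      ← ENNReal.ofReal_div_of_pos (by positivity)] at h
    have h2 := ((ENNReal.ofReal_lt_ofReal_iff').1 h).1
    rw [lt_div_iff₀ (by positivity)] at h2
    exact ⟨x, y, hxy, h2.le⟩
  -- The two points are exchanged if necessary, to fix the sign of the increment.
  obtain ⟨a, b, hab, hq'⟩ : ∃ a b, a ≠ b ∧ (1 - δ) * ‖b - a‖ ^ α ≤ f b - f a := by
    rcases le_total (f y) (f x) with h | h
    · exact ⟨y, x, hxy.symm, by rwa [abs_of_nonneg (sub_nonneg.2 h)] at hq⟩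
    · exact ⟨x, y, hxy, by rwa [abs_sub_comm, abs_of_nonneg (sub_nonneg.2 h), norm_sub_rev] at hq⟩
  set r := ‖b - a‖ with hr
  have hr0 : 0 < r := norm_pos_iff.2 (sub_ne_zero.2 hab.symm)
  have hrα : 0 < r ^ α := Real.rpow_pos_of_pos hr0 _
  have hs : ContDiff ℝ ∞ fun z => f (a + r • z) :=
    hf.1.comp (contDiff_const.add (contDiff_const_smul r))
  refine ⟨fun z => (r ^ α)⁻¹ * (f (a + r • z) - f a), r⁻¹ • (b - a),
    contDiff_const.mul (hs.sub contDiff_const), by simp, fun z w => ?_, ?_, ?_, ?_⟩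
  · have h := hfα (a + r • z) (a + r • w)
    rw [add_sub_add_left_eq_sub, ← smul_sub, norm_smul, Real.norm_of_nonneg hr0.le,
      Real.mul_rpow hr0.le (norm_nonneg _)] at h
    rw [← mul_sub, sub_sub_sub_cancel_right, abs_mul, abs_of_pos (inv_pos.2 hrα),
      inv_mul_le_iff₀ hrα]
    exact h
  · rw [norm_smul, norm_inv, Real.norm_of_nonneg hr0.le, ← hr, inv_mul_cancel₀ hr0.ne']
  · simp only
    rw [smul_inv_smul₀ hr0.ne', add_sub_cancel, inv_mul_eq_div, le_div_iff₀ hrα]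
    exact hq'
  · have h1 : sobolevSeminorm s p (fun z => (r ^ α)⁻¹ * (f (a + r • z) - f a)) =
        sobolevSeminorm s p f := by
      rw [sobolevSeminorm_const_mul hp ((hs.sub contDiff_const).of_le (by simp)),
        sobolevSeminorm_sub_const hp (hs.of_le (by simp)),
        sobolevSeminorm_comp_affine hp (TestFun.contDiff_one hf) a hr0,
        Real.enorm_of_nonneg (by positivity), ← mul_assoc, ← ENNReal.ofReal_mul (by positivity),
        inv_mul_cancel₀ hrα.ne', ENNReal.ofReal_one, one_mul]
    rw [h1]
    exact hfm.le

theorem isCompact_holder {α : ℝ} (hα : 0 < α) : IsCompact {f : C(Space N, ℝ) |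
    f 0 = 0 ∧ ∀ x y, |f x - f y| ≤ ‖x - y‖ ^ α} := by
  refine ArzelaAscoli.isCompact_of_equicontinuous _ ?_ ?_
  · have himg : ContinuousMap.toFun '' {f : C(Space N, ℝ) |
        f 0 = 0 ∧ ∀ x y, |f x - f y| ≤ ‖x - y‖ ^ α} =
        {f : Space N → ℝ | f 0 = 0 ∧ ∀ x y, |f x - f y| ≤ ‖x - y‖ ^ α} := by
      ext f
      refine ⟨?_, fun hf => ?_⟩
      · rintro ⟨g, hg, rfl⟩
        exact hg
      · have hc : Continuous f := by
          refine continuous_iff_continuousAt.2 fun x => tendsto_iff_dist_tendsto_zero.2 ?_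
          refine squeeze_zero (fun _ => dist_nonneg) (fun y => hf.2 y x) ?_
          have : Continuous fun y : Space N => ‖y - x‖ ^ α :=
            (continuous_id.sub continuous_const).norm.rpow_const fun _ => .inr hα.le
          simpa [Real.zero_rpow hα.ne'] using this.tendsto x
        exact ⟨⟨f, hc⟩, hf, rfl⟩
    rw [himg]
    refine (isCompact_univ_pi fun x : Space N => isCompact_Icc (a := -‖x‖ ^ α)
      (b := ‖x‖ ^ α)).of_isClosed_subset ?_ ?_
    · have h : IsClosed ({f : Space N → ℝ | f 0 = 0} ∩ ⋂ (x : Space N) (y : Space N),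
          {f : Space N → ℝ | |f x - f y| ≤ ‖x - y‖ ^ α}) :=
        (isClosed_eq (continuous_apply 0) continuous_const).inter
          (isClosed_iInter fun x => isClosed_iInter fun y =>
            isClosed_le (((continuous_apply x).sub (continuous_apply y)).abs) continuous_const)
      convert h using 1
      ext f
      simp
    · rintro f ⟨hf0, hf⟩ x -
      have := hf x 0
      rw [hf0, sub_zero, sub_zero] at this
      exact abs_le.1 this
  · refine Metric.equicontinuous_of_continuity_modulus (fun t => t ^ α) ?_ _ fun x y f => ?_
    · have := (Real.continuous_rpow_const hα.le).tendsto 0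
      rwa [Real.zero_rpow hα.ne'] at this
    · rw [dist_eq_norm x y]
      exact f.2.2 x y

/-! ### Existence of a minimiser -/

theorem exists_minimizer (hN : 1 ≤ N) {s p : ℝ} (hs0 : 0 < s) (hs1 : s ≤ 1) (hp : 1 < p)
    (hsp : (N : ℝ) < s * p) : ∃ u : Space N → ℝ, Continuous u ∧
      holderSeminorm (holderExponent N s p) u = 1 ∧
      sobolevSeminorm s p u ^ p ≤ morreyConstant N s p := by
  have hp0 : 0 < p := by linarith
  have hα := holderExponent_pos hp hsp
  have hmt := (morreyConstant_lt_top hN hs0 hs1 hp hsp).ne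
  set α := holderExponent N s p
  set m := morreyConstant N s p
  choose g e hgs hg0 hgα he hge hgm using fun n : ℕ =>
    exists_almost_extremal hN hs0 hs1 hp hsp (δ := 1 / ((n : ℝ) + 1)) (by positivity)
  obtain ⟨⟨u, w⟩, ⟨hu, hw⟩, φ, hφ, hlim⟩ := ((isCompact_holder (N := N) hα).prod
    (isCompact_sphere (0 : Space N) 1)).tendsto_subseq
    (x := fun n => ((⟨g n, (hgs n).continuous⟩ : C(Space N, ℝ)), e n))
    fun n => ⟨⟨hg0 n, hgα n⟩, by simpa using he n⟩
  rw [nhds_prod_eq] at hlim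
  have hgu : ∀ x, Tendsto (fun n => g (φ n) x) atTop (𝓝 (u x)) := fun x =>
    ((continuous_eval_const x).tendsto u).comp hlim.fst
  have hew : Tendsto (fun n => e (φ n)) atTop (𝓝 w) := hlim.snd
  have hδ : Tendsto (fun n => 1 / ((φ n : ℝ) + 1)) atTop (𝓝 0) :=
    (tendsto_one_div_add_atTop_nhds_zero_nat (𝕜 := ℝ)).comp hφ.tendsto_atTop
  have hw1 : ‖w‖ = 1 := by simpa using hw
  -- The Hölder quotients at `0` and `e (φ n)` tend to one, and the Hölder bound is uniform.
  have huw : u w = 1 := by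
    refine le_antisymm ?_ ?_
    · have h := (le_abs_self _).trans (hu.2 w 0)
      rwa [hu.1, sub_zero, sub_zero, hw1, Real.one_rpow] at h
    · have h1 : Tendsto (fun n => ‖e (φ n) - w‖ ^ α) atTop (𝓝 0) := by
        have := (tendsto_iff_norm_sub_tendsto_zero.1 hew).rpow_const (p := α) (.inr hα.le)
        rwa [Real.zero_rpow hα.ne'] at this
      have h2 : ∀ n, 1 - 1 / ((φ n : ℝ) + 1) ≤ g (φ n) w + ‖e (φ n) - w‖ ^ α := fun n => by
        have h3 := (le_abs_self _).trans (hgα (φ n) (e (φ n)) w)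
        have h4 := hge (φ n)
        linarith
      have h5 := le_of_tendsto_of_tendsto' (tendsto_const_nhds.sub hδ) ((hgu w).add h1) h2
      simpa using h5
  have hB : Tendsto (fun n => m + ENNReal.ofReal (1 / ((φ n : ℝ) + 1))) atTop (𝓝 m) := by
    simpa using (ENNReal.tendsto_ofReal hδ).const_add m
  refine ⟨u, u.continuous, le_antisymm (holderSeminorm_le fun x y => ?_) ?_, ?_⟩
  · rw [one_mul, ← ofReal_norm, ← ofReal_norm,
      ENNReal.ofReal_rpow_of_nonneg (norm_nonneg _) hα.le]
    exact ENNReal.ofReal_le_ofReal (hu.2 x y)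
  · have hw0 : w ≠ 0 := by
      intro h
      simp [h] at hw1
    refine le_iSup_of_le w (le_iSup_of_le 0 (le_iSup_of_le hw0 (le_of_eq ?_)))
    rw [huw, hu.1, sub_zero, sub_zero, ← ofReal_norm w, hw1]
    simp
  · by_cases hs : s = 1
    · subst hs
      simp only [sobolevSeminorm, if_true] at hgm ⊢
      have hg1 : ∀ n, ContDiff ℝ 1 (g n) := fun n => (hgs n).of_le (by simp)
      have hint : ∀ k : Space N → ℝ, ContDiff ℝ 1 k →
          gradientSeminorm p k ^ p = ∫⁻ x, ‖gradient k x‖ₑ ^ p := fun k hk => by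
        rw [(isWeakGradient_gradient hk).gradientSeminorm_eq, ← ENNReal.rpow_mul,
          one_div_mul_cancel hp0.ne', ENNReal.rpow_one]
      -- The midpoint of two members is admissible in Morrey's inequality, and it is almost
      -- normalised because both members almost attain the Hölder quotient at `0` and `w`.
      have hmid : ∀ q : ℕ × ℕ,
          (m ^ (1 / p) * ‖(1 / 2 : ℝ) * (g (φ q.1) w + g (φ q.2) w)‖ₑ) ^ p ≤
            ∫⁻ x, ‖(1 / 2 : ℝ) • (gradient (g (φ q.1)) x + gradient (g (φ q.2)) x)‖ₑ ^ p := by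
        intro q
        have h1 : ContDiff ℝ ∞ fun x => (1 / 2 : ℝ) * (g (φ q.1) x + g (φ q.2) x) :=
          contDiff_const.mul ((hgs _).add (hgs _))
        have h2 := morreyBound_of_contDiff hN hs0 hs1 hp hsp h1 w 0
        simp only [hg0, add_zero, mul_zero, sub_zero] at h2
        rw [← ofReal_norm w, hw1, ENNReal.ofReal_one, ENNReal.one_rpow, mul_one] at h2
        refine (ENNReal.rpow_le_rpow h2 hp0.le).trans (le_of_eq ?_)
        simp only [sobolevSeminorm, if_true]
        rw [hint _ (h1.of_le (by simp))]
        refine lintegral_congr fun x => ?_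
        have hd1 := (hg1 (φ q.1)).differentiable one_ne_zero x
        have hd2 := (hg1 (φ q.2)).differentiable one_ne_zero x
        simp only [gradient]
        have hd : fderiv ℝ (fun x => (1 / 2 : ℝ) * (g (φ q.1) x + g (φ q.2) x)) x =
            (1 / 2 : ℝ) • (fderiv ℝ (g (φ q.1)) x + fderiv ℝ (g (φ q.2)) x) :=
          ((hd1.hasFDerivAt.add hd2.hasFDerivAt).const_mul (1 / 2)).fderiv
        rw [hd, map_smul, map_add]
      obtain ⟨G, hG, hGm, hGt⟩ := exists_tendsto_eLpNorm_sub_of_midpoint hp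
        (A := fun n => gradient (g (φ n))) (fun n =>
          (isWeakGradient_gradient (hg1 (φ n))).locallyIntegrable_grad.aestronglyMeasurable) hmt
        (fun n => by finiteness) (fun n => by rw [← hint _ (hg1 _)]; exact hgm (φ n)) hB
        (L := fun q => (m ^ (1 / p) * ‖(1 / 2 : ℝ) * (g (φ q.1) w + g (φ q.2) w)‖ₑ) ^ p) (by
          have hfst : Tendsto Prod.fst (atTop : Filter (ℕ × ℕ)) atTop := by
            rw [← prod_atTop_atTop_eq]; exact tendsto_fst
          have hsnd : Tendsto Prod.snd (atTop : Filter (ℕ × ℕ)) atTop := by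
            rw [← prod_atTop_atTop_eq]; exact tendsto_snd
          have h1 := ((((hgu w).comp hfst).add ((hgu w).comp hsnd)).const_mul (1 / 2 : ℝ)).enorm
          rw [huw] at h1
          norm_num at h1
          have h2 := ENNReal.Tendsto.const_mul (a := m ^ (1 / p)) h1
            (.inr (ENNReal.rpow_ne_top_of_nonneg (by positivity) hmt))
          have h3 := (ENNReal.continuous_rpow_const (y := p)).tendsto _ |>.comp h2
          rw [mul_one, ← ENNReal.rpow_mul, one_div_mul_cancel hp0.ne', ENNReal.rpow_one] at h3
          refine h3.congr fun q => ?_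
          simp) hmid
      have hW : IsWeakGradient u G := IsWeakGradient.of_tendsto hp (b := fun x => ‖x‖ ^ α)
        (fun n => isWeakGradient_gradient (hg1 (φ n))) u.continuous
        (continuous_norm.rpow_const fun _ => .inr hα.le)
        (fun n x => by simpa [hg0] using hgα (φ n) x 0) hgu hG hGt
      rw [hW.gradientSeminorm_eq, ← ENNReal.rpow_mul, one_div_mul_cancel hp0.ne',
        ENNReal.rpow_one]
      exact hGm
    · simp only [sobolevSeminorm, if_neg hs] at hgm ⊢
      exact gagliardoSeminorm_rpow_le_of_tendsto hp (fun n => (hgs (φ n)).continuous) hgu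
        (fun n => hgm (φ n)) hB

end Morrey

theorem theorem6p1 (N : ℕ) (hN : 1 ≤ N) (s p : ℝ) (hs0 : 0 < s) (hs1 : s ≤ 1) (hp : 1 < p)
    (hsp : (N : ℝ) < s * p) :
    Morrey.morreyConstant N s p = Morrey.relaxedMorreyConstant N s p ∧
    (∃ u ∈ Morrey.HomogeneousSobolev N s p,
      Morrey.holderSeminorm (Morrey.holderExponent N s p) u = 1 ∧
      Morrey.sobolevSeminorm s p u ^ p = Morrey.relaxedMorreyConstant N s p) ∧
    (∃ u : Morrey.Space N → ℝ, Morrey.IsExtremal s p u) := by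
  have heq := Morrey.morreyConstant_eq_relaxedMorreyConstant hN hs0 hs1 hp hsp
  have hp0 : 0 < p := by linarith
  obtain ⟨u, huc, hu1, hum⟩ := Morrey.exists_minimizer hN hs0 hs1 hp hsp
  have hfin : Morrey.sobolevSeminorm s p u < ⊤ := by
    rw [← ENNReal.rpow_lt_top_iff_of_pos hp0]
    exact hum.trans_lt (Morrey.morreyConstant_lt_top hN hs0 hs1 hp hsp)
  have hmem : u ∈ Morrey.HomogeneousSobolev N s p := ⟨⟨huc, by simp [hu1]⟩, hfin⟩
  have hval : Morrey.sobolevSeminorm s p u ^ p = Morrey.morreyConstant N s p := by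
    refine le_antisymm hum ?_
    simpa [hu1] using Morrey.morreyConstant_mul_holderSeminorm_rpow_le hN hs0 hs1 hp hsp huc
  refine ⟨heq, ⟨u, hmem, hu1, hval.trans heq⟩, u, hmem, ?_, ?_⟩
  · rintro ⟨c, hc⟩
    have h0 : Morrey.holderSeminorm (Morrey.holderExponent N s p) u = 0 := by
      simp [Morrey.holderSeminorm, hc]
    exact zero_ne_one (h0.symm.trans hu1)
  · rw [hval, hu1, ENNReal.one_rpow, mul_one]
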